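/- **Setting.** $\partial f$ and $\partial^\infty f$ denote the limiting (Mordukhovich) and horizon subdifferentials of $f:\mathbb{R}^d\to\overline{\mathbb{R}}$ at points where $f$ is finite, $N_C$ the limiting normal cone, $\operatorname{dom} f=\{f<+\infty\}$, $\varphi^*$ the convex conjugate. A proper lsc convex function $\varphi$ is *Legendre* if it is essentially smooth ($\operatorname{int}\operatorname{dom}\varphi\ne\emptyset$, $\varphi$ is differentiable there, and $\|\nabla\varphi(x^\nu)\|\to\infty$ whenever $\operatorname{int}\operatorname{dom}\varphi\ni x^\nu\to x\in\operatorname{bdry}\operatorname{dom}\varphi$) and essentially strictly convex (strictly convex on every convex subset of $\operatorname{dom}\partial\varphi$). Its Bregman distance is $D_\varphi(x,y)=\varphi(x)-\varphi(y)-\langle\nabla\varphi(y),x-y\rangle$ if $y\in\operatorname{int}\operatorname{dom}\varphi$ and $+\infty$ otherwise. The left Bregman–Moreau envelope is $\operatorname{env}_\lambda f(y)=\inf_x f(x)+\frac1\lambda D_\varphi(x,y)$. A function $f$ is *prox-regular relative to $\varphi$* at $\bar x\in\operatorname{int}\operatorname{dom}\varphi$ for $\bar v$ if $f$ is finite and locally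 lsc at $\bar x$, $\bar v\in\partial f(\bar x)$, and there are $\varepsilon>0$, $r\ge0$ such that the open ball $B(\bar x,\varepsilon)$ lies in $\operatorname{int}\operatorname{dom}\varphi$ and $$f(x')\ge f(x)+\langle v,x'-x\rangle-r\,D_\varphi(x',x)$$ whenever $x,x'\in B(\bar x,\varepsilon)$, $f(x)<f(\bar x)+\varepsilon$, $v\in\partial f(x)$, $\|v-\bar v\|<\varepsilon$. **Theorem.** Let $\varphi:\mathbb{R}^m\to\overline{\mathbb{R}}$ be Legendre and super-coercive ($\varphi(x)/\|x\|\to\infty$ as $\|x\|\to\infty$), let $f:\mathbb{R}^m\to\overline{\mathbb{R}}$ be proper lsc with $\operatorname{dom} f\cap\operatorname{dom}\varphi\neq\emptyset$, and assume the constraint qualification $$\partial^\infty f(x)\cap -N_{\operatorname{dom}\varphi}(x)=\{0\}\qquad\text{for all }x\in\operatorname{dom} f\cap\operatorname{dom}\varphi .$$ Let $\sigma$ on $\mathbb{R}^m$ and $\omega$ on $\mathbb{R}^n$ be Legendre with $\operatorname{dom}\sigma\supseteq\operatorname{dom}\varphi$ and $\operatorname{dom}\omega=\mathbb{R}^n$,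 let $g:\mathbb{R}^n\to\overline{\mathbb{R}}$ be proper lsc, $A:\mathbb{R}^n\to\mathbb{R}^m$ linear, $\lambda>0$, and assume that $$F_\lambda(u,x)=f(x)+\tfrac1\lambda D_\varphi(x,\nabla\varphi^*(Au))+g(u)$$ is coercive on $\mathbb{R}^n\times\mathbb{R}^m$ ($F_\lambda(u,x)\to\infty$ as $\|(u,x)\|\to\infty$). Let $x^0\in\operatorname{int}\operatorname{dom}\varphi$, $u^0\in\mathbb{R}^n$ and, for $t=0,1,2,\dots$, $$x^{t+1}\in\operatorname*{argmin}_{x\in\mathbb{R}^m}F_\lambda(u^t,x)+D_\sigma(x,x^t),\qquad u^{t+1}\in\operatorname*{argmin}_{u\in\mathbb{R}^n}F_\lambda(u,x^{t+1})+D_\omega(u,u^t)$$ (a function that is identically $+\infty$ has empty argmin). Let $(u^*,x^*)$ be a limit point (the limit of a subsequence) of $(u^t,x^t)_t$. 1. If $x^*\in\operatorname{int}\operatorname{dom}\sigma$ (which holds automatically when $\operatorname{dom}\varphi\subseteq\operatorname{int}\operatorname{dom}\sigma$, in particular when $\operatorname{dom}\sigma$ is open), then $0\in\partial F_\lambda(u^*,x^*)$,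 $x^*\in\operatorname{int}\operatorname{dom}\varphi$, and $$0\in\partial f(x^*)+\tfrac1\lambda\big(\nabla\varphi(x^*)-Au^*\big),\qquad 0\in\partial g(u^*)+\tfrac1\lambda A^*\big(\nabla\varphi^*(Au^*)-x^*\big).$$ 2. If $f$ is prox-regular relative to $\varphi$ at $x^*$ for $v^*\in\partial f(x^*)$, $Au^*=\nabla\varphi(x^*)+\lambda v^*$, and $\lambda$ is sufficiently small, i.e. $\lambda<\bar\lambda$ for a constant $\bar\lambda>0$ that depends only on $\varphi,f,x^*,v^*$, then $$0\in\partial\big(\operatorname{env}_\lambda f\circ\nabla\varphi^*\circ A+g\big)(u^*).$$ -/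

import Mathlib

open Filter Topology

noncomputable section

namespace BregmanPAM

section General

variable {E : Type*} [NormedAddCommGroup E] [InnerProductSpace ℝ E]

/-- The (effective) domain of an extended real-valued function. -/
def dom (f : E → EReal) : Set E := {x | f x < ⊤}

/-- `f` never takes the value `-∞` and is not identically `+∞`. -/
def Proper (f : E → EReal) : Prop := (∀ x, ⊥ < f x) ∧ ∃ x, f x < ⊤

/-- The class `Γ₀` of proper, lower semicontinuous, convex functions
(convexity is convexity of the epigraph). -/
structure GammaZero (φ : E → EReal) : Prop where
  proper : Proper φ
  lsc : LowerSemicontinuous φ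
  convex : Convex ℝ {p : E × ℝ | φ p.1 ≤ (p.2 : EReal)}

/-- `f x → ∞` as `‖x‖ → ∞`. -/
def Coercive (f : E → EReal) : Prop :=
  Tendsto f (comap (fun x : E => ‖x‖) atTop) (𝓝 ⊤)

/-- `f x / ‖x‖ → ∞` as `‖x‖ → ∞`. -/
def SuperCoercive (f : E → EReal) : Prop :=
  Tendsto (fun x => f x / ((‖x‖ : ℝ) : EReal)) (comap (fun x : E => ‖x‖) atTop) (𝓝 ⊤)

/-- The minimizers of an extended real-valued function; as usual in variational analysis the
function that is identically `+∞` has no minimizers. -/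
def argminSet (f : E → EReal) : Set E := {x | f x < ⊤ ∧ ∀ y, f x ≤ f y}

/-- The subgradients of convex analysis. -/
def convexSubdiff (φ : E → EReal) (x : E) : Set E :=
  {v | φ x ≠ ⊤ ∧ φ x ≠ ⊥ ∧ ∀ y, φ x + ((inner ℝ v (y - x) : ℝ) : EReal) ≤ φ y}

/-- Regular (Fréchet) subgradients: `f x` is finite and
`f y ≥ f x + ⟪v, y - x⟫ + o(‖y - x‖)`. -/
def regularSubdiff (f : E → EReal) (x : E) : Set E :=
  {v | f x ≠ ⊤ ∧ f x ≠ ⊥ ∧ ∀ ε : ℝ, 0 < ε →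
    ∀ᶠ y in 𝓝 x, f x + ((inner ℝ v (y - x) - ε * ‖y - x‖ : ℝ) : EReal) ≤ f y}

/-- Limiting (Mordukhovich) subgradients, the set `∂f(x)`. -/
def limitingSubdiff (f : E → EReal) (x : E) : Set E :=
  {v | f x ≠ ⊤ ∧ f x ≠ ⊥ ∧ ∃ (y w : ℕ → E),
    Tendsto y atTop (𝓝 x) ∧ Tendsto (fun k => f (y k)) atTop (𝓝 (f x)) ∧
    (∀ k, w k ∈ regularSubdiff f (y k)) ∧ Tendsto w atTop (𝓝 v)}

/-- Horizon subgradients, the set `∂^∞ f(x)`. -/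
def horizonSubdiff (f : E → EReal) (x : E) : Set E :=
  {v | f x ≠ ⊤ ∧ f x ≠ ⊥ ∧ ∃ (y w : ℕ → E) (c : ℕ → ℝ),
    Tendsto y atTop (𝓝 x) ∧ Tendsto (fun k => f (y k)) atTop (𝓝 (f x)) ∧
    (∀ k, w k ∈ regularSubdiff f (y k)) ∧
    (∀ k, 0 < c k) ∧ Tendsto c atTop (𝓝 0) ∧ Tendsto (fun k => c k • w k) atTop (𝓝 v)}

/-- Regular normals to a set `C` at a point `x ∈ C`. -/
def regularNormalCone (C : Set E) (x : E) : Set E :=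
  {v | x ∈ C ∧ ∀ ε : ℝ, 0 < ε → ∀ᶠ y in 𝓝[C] x, inner ℝ v (y - x) ≤ ε * ‖y - x‖}

/-- The (limiting) normal cone `N_C(x)` to a set `C` at a point `x ∈ C`. -/
def normalCone (C : Set E) (x : E) : Set E :=
  {v | x ∈ C ∧ ∃ (y w : ℕ → E), Tendsto y atTop (𝓝 x) ∧
    (∀ k, w k ∈ regularNormalCone C (y k)) ∧ Tendsto w atTop (𝓝 v)}

/-- The convex conjugate `φ*`. -/
def conj (φ : E → EReal) (y : E) : EReal :=
  ⨆ x : E, (((inner ℝ x y : ℝ) : EReal) - φ x)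

/-- `f` is locally lower semicontinuous at `x`. -/
def LocallyLscAt (f : E → EReal) (x : E) : Prop :=
  ∃ ε : ℝ, 0 < ε ∧ ∀ α : ℝ, (α : EReal) ≤ f x + (ε : EReal) →
    IsClosed {y : E | ‖y - x‖ ≤ ε ∧ f y ≤ (α : EReal)}

variable [CompleteSpace E]

/-- The gradient of an extended real-valued function; it is only used at interior points of the
domain of a proper function, near which the function is real-valued. -/
def grad (φ : E → EReal) (x : E) : E := gradient (fun y => (φ y).toReal) x

/-- Essentially smooth functions. -/
def EssentiallySmooth (φ : E → EReal) : Prop :=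
  (interior (dom φ)).Nonempty ∧
  (∀ x ∈ interior (dom φ), DifferentiableAt ℝ (fun y => (φ y).toReal) x) ∧
  (∀ x ∈ frontier (dom φ), Tendsto (fun y => ‖grad φ y‖) (𝓝[interior (dom φ)] x) atTop)

/-- Essentially strictly convex functions. -/
def EssentiallyStrictlyConvex (φ : E → EReal) : Prop :=
  ∀ C : Set E, Convex ℝ C → C ⊆ {x | (convexSubdiff φ x).Nonempty} →
    StrictConvexOn ℝ C (fun y => (φ y).toReal)

/-- Legendre functions in `Γ₀`. -/
structure Legendre (φ : E → EReal) : Prop where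
  gammaZero : GammaZero φ
  smooth : EssentiallySmooth φ
  strict : EssentiallyStrictlyConvex φ

open Classical in
/-- The Bregman distance `D_φ(x, y)`, equal to `+∞` if `y ∉ int dom φ`. -/
def bregman (φ : E → EReal) (x y : E) : EReal :=
  if y ∈ interior (dom φ) then φ x - φ y - ((inner ℝ (grad φ y) (x - y) : ℝ) : EReal) else ⊤

/-- The left Bregman--Moreau envelope `env_λ f`. -/
def leftEnv (φ f : E → EReal) (lam : ℝ) (y : E) : EReal :=
  ⨅ x : E, (f x + ((1 / lam : ℝ) : EReal) * bregman φ x y)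

/-- The constraint qualification `∂^∞ f(x) ∩ -N_{dom φ}(x) = {0}` on `dom f ∩ dom φ`. -/
def Qualification (φ f : E → EReal) : Prop :=
  ∀ x ∈ dom f ∩ dom φ, horizonSubdiff f x ∩ {v | -v ∈ normalCone (dom φ) x} = {0}

/-- `f` is prox-regular relative to `φ` at `x₀` for `v₀`. -/
def RelProxRegular (φ f : E → EReal) (x₀ v₀ : E) : Prop :=
  x₀ ∈ interior (dom φ) ∧ f x₀ ≠ ⊤ ∧ f x₀ ≠ ⊥ ∧ LocallyLscAt f x₀ ∧
  v₀ ∈ limitingSubdiff f x₀ ∧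
  ∃ ε r : ℝ, 0 < ε ∧ 0 ≤ r ∧ Metric.ball x₀ ε ⊆ interior (dom φ) ∧
    ∀ x' ∈ Metric.ball x₀ ε, ∀ x ∈ Metric.ball x₀ ε, f x < f x₀ + (ε : EReal) →
      ∀ v ∈ limitingSubdiff f x, ‖v - v₀‖ < ε →
        f x + ((inner ℝ v (x' - x) : ℝ) : EReal) - (r : EReal) * bregman φ x' x ≤ f x'

end General

/-- `ℝᵈ` with its Euclidean norm. -/
abbrev Euc (d : ℕ) : Type := EuclideanSpace ℝ (Fin d)

/-- `ℝⁿ × ℝᵐ` with its Euclidean norm and inner product. -/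
abbrev EucProd (n m : ℕ) : Type := WithLp 2 (Euc n × Euc m)

variable {n m : ℕ}

/-- The pair `(u, x)`. -/
abbrev pair (u : Euc n) (x : Euc m) : EucProd n m := WithLp.toLp 2 (u, x)

/-- `F_λ(u, x) = f(x) + (1/λ) D_φ(x, ∇φ*(A u)) + g(u)`. -/
def objective (φ f : Euc m → EReal) (g : Euc n → EReal) (A : Euc n →ₗ[ℝ] Euc m) (lam : ℝ)
    (z : EucProd n m) : EReal :=
  f z.snd + ((1 / lam : ℝ) : EReal) * bregman φ z.snd (grad (conj φ) (A z.fst)) + g z.fst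

/-- The function `env_λ f ∘ ∇φ* ∘ A + g`. -/
def relaxation (φ f : Euc m → EReal) (g : Euc n → EReal) (A : Euc n →ₗ[ℝ] Euc m) (lam : ℝ)
    (u : Euc n) : EReal :=
  leftEnv φ f lam (grad (conj φ) (A u)) + g u

/-- `(u, x)` is a sequence of iterates of Bregman proximal alternating minimization. -/
structure IsPAMRun (φ σ f : Euc m → EReal) (ω g : Euc n → EReal) (A : Euc n →ₗ[ℝ] Euc m)
    (lam : ℝ) (u : ℕ → Euc n) (x : ℕ → Euc m) : Prop where
  init : x 0 ∈ interior (dom φ)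
  x_update : ∀ t, x (t + 1) ∈
    argminSet (fun y => objective φ f g A lam (pair (u t) y) + bregman σ y (x t))
  u_update : ∀ t, u (t + 1) ∈
    argminSet (fun w => objective φ f g A lam (pair w (x (t + 1))) + bregman ω w (u t))

/-- `(us, xs)` is a limit point (the limit of a subsequence) of the sequence `(u, x)`. -/
def IsLimitPoint (u : ℕ → Euc n) (x : ℕ → Euc m) (us : Euc n) (xs : Euc m) : Prop :=
  ∃ s : ℕ → ℕ, StrictMono s ∧ Tendsto (fun j => u (s j)) atTop (𝓝 us) ∧
    Tendsto (fun j => x (s j)) atTop (𝓝 xs)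

end BregmanPAM

end

/-! Super-coercivity makes `∂φ` surjective, and the Legendre property makes it single-valued and
injective. So `∇φ*` is a continuous inverse of `∇φ`, and `D_φ(x, ∇φ*(Au)) = φ(x) + φ*(Au) - ⟪Au,
x⟫`. Thus `F_λ` is `f + φ/λ` in `x`, plus `g` in `u`, plus a differentiable coupling.

Each iteration lowers `F_λ` by at least `D_σ(x⁺, x) + D_ω(u⁺, u)`. Coercivity and semicontinuity
bound `F_λ` below, so these distances vanish, and consecutive iterates share the limit `(u*, x*)`
along a subsequence. Passing to the limit in the subproblems (`IsPAMRun.limit_minimizes`), each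
component of the limit minimizes its subproblem centred at the limit itself, where the proximal
terms have zero gradient.

Fermat's rule needs `x*` interior to `dom φ` (`mem_interior_of_qualified_min`). Splitting `f(y) +
φ(z)/λ` with a quadratic penalty yields multipliers. If these are bounded along a subsequence, they
produce a subgradient of `φ` at `x*`, which exists only at interior points. If they blow up, their
normalized limit violates the constraint qualification. The partial conditions then combine by
convexity of `φ` and `φ*`: the only cross term is `⟪A(u - u*), x - x*⟫/λ`, which is of second order.

For the relaxation, prox-regularity is first made global: `f(x) ≥ f(x*) + ⟪v*, x - x*⟫ - R D_φ(x,
x*)` (`RelProxRegular.exists_global`). If `1/λ ≥ R + 1`, the inner problem of the envelope at `u*`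
grows at least like `D_φ(x, x*)`. This absorbs the cross term uniformly in `x`, up to an error `ε‖u
- u*‖`, and gives a first-order lower estimate of the envelope whose slope cancels the subgradient
of `g`. -/

noncomputable section

namespace BregmanPAM

/-! ### Real values of extended functions and semicontinuous limits -/

section Basic

variable {E : Type*}

theorem Proper.coe_toReal {f : E → EReal} (hf : Proper f) {x : E} (hx : x ∈ dom f) :
    ((f x).toReal : EReal) = f x :=
  EReal.coe_toReal (ne_of_lt hx) (hf.1 x).ne'

theorem dom_of_le_coe {f : E → EReal} {x : E} {c : ℝ} (h : f x ≤ (c : EReal)) : x ∈ dom f :=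
  lt_of_le_of_lt h (EReal.coe_lt_top c)

theorem Proper.toReal_le {f : E → EReal} (hf : Proper f) {x : E} {c : ℝ}
    (h : f x ≤ (c : EReal)) : (f x).toReal ≤ c := by
  rw [← hf.coe_toReal (dom_of_le_coe h)] at h
  exact_mod_cast h

variable [TopologicalSpace E]

/-- A lower semicontinuous function that avoids `-∞` is bounded below on compact sets. -/
theorem exists_lower_bound {f : E → EReal} (hf : ∀ x, ⊥ < f x) (hlsc : LowerSemicontinuous f)
    {K : Set E} (hK : IsCompact K) : ∃ c : ℝ, ∀ x ∈ K, (c : EReal) ≤ f x := by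
  rcases K.eq_empty_or_nonempty with rfl | hne
  · exact ⟨0, by simp⟩
  obtain ⟨a, ha, hmin⟩ := LowerSemicontinuousOn.exists_isMinOn hne hK (hlsc.lowerSemicontinuousOn K)
  obtain ⟨c, hc⟩ := EReal.lt_iff_exists_real_btwn.1 (hf a)
  exact ⟨c, fun x hx => hc.2.le.trans (hmin hx)⟩

/-- The epigraph is closed. Since the limiting bound is real, membership of the limit point in the
domain follows as well. -/
theorem le_of_lsc_of_tendsto {α : Type*} {l : Filter α} [l.NeBot] {f : E → EReal}
    (hlsc : LowerSemicontinuous f) {y : α → E} {c : α → ℝ} {x : E} {d : ℝ}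
    (hy : Tendsto y l (𝓝 x)) (hc : Tendsto c l (𝓝 d))
    (h : ∀ᶠ j in l, f (y j) ≤ (c j : EReal)) : f x ≤ (d : EReal) := by
  have h1 : Tendsto (fun j => (y j, (c j : EReal))) l (𝓝 (x, (d : EReal))) :=
    hy.prodMk_nhds ((continuous_coe_real_ereal.tendsto d).comp hc)
  exact hlsc.isClosed_epigraph.mem_of_tendsto h1 h

end Basic

/-! ### Convex subgradients and Bregman distances -/

section Convex

variable {E : Type*} [NormedAddCommGroup E] [InnerProductSpace ℝ E]

theorem GammaZero.convexOn {φ : E → EReal} (h : GammaZero φ) :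
    ConvexOn ℝ (dom φ) (fun y => (φ y).toReal) := by
  have key : ∀ x ∈ dom φ, ∀ y ∈ dom φ, ∀ a b : ℝ, 0 ≤ a → 0 ≤ b → a + b = 1 →
      φ (a • x + b • y) ≤ ((a * (φ x).toReal + b * (φ y).toReal : ℝ) : EReal) := by
    intro x hx y hy a b ha hb hab
    have h1 : (x, (φ x).toReal) ∈ {p : E × ℝ | φ p.1 ≤ (p.2 : EReal)} :=
      (h.proper.coe_toReal hx).ge
    have h2 : (y, (φ y).toReal) ∈ {p : E × ℝ | φ p.1 ≤ (p.2 : EReal)} :=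
      (h.proper.coe_toReal hy).ge
    exact h.convex h1 h2 ha hb hab
  refine ⟨fun x hx y hy a b ha hb hab => dom_of_le_coe (key x hx y hy a b ha hb hab), ?_⟩
  intro x hx y hy a b ha hb hab
  exact h.proper.toReal_le (key x hx y hy a b ha hb hab)

/-- A convex function with a first-order lower estimate at a point has a subgradient there. -/
theorem subgradient_of_eventually {C : Set E} {p : E → ℝ} (hp : ConvexOn ℝ C p) {x z v : E}
    (hx : x ∈ C) (hz : z ∈ C)
    (h : ∀ ε : ℝ, 0 < ε → ∀ᶠ y in 𝓝 x, y ∈ C → p x + inner ℝ v (y - x) - ε * ‖y - x‖ ≤ p y) :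
    p x + inner ℝ v (z - x) ≤ p z := by
  have key : ∀ ε : ℝ, 0 < ε → p x + inner ℝ v (z - x) - ε * ‖z - x‖ ≤ p z := by
    intro ε hε
    have hlim : Tendsto (fun t : ℝ => x + t • (z - x)) (𝓝[>] 0) (𝓝 x) := by
      have : Tendsto (fun t : ℝ => x + t • (z - x)) (𝓝 0) (𝓝 (x + (0 : ℝ) • (z - x))) := by
        apply Continuous.tendsto; fun_prop
      simp only [zero_smul, add_zero] at this
      exact this.mono_left nhdsWithin_le_nhds
    have h1 : ∀ᶠ t : ℝ in 𝓝[>] 0, t < 1 :=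
      nhdsWithin_le_nhds (Iio_mem_nhds one_pos)
    -- A single small step `t` towards `z` suffices: the local estimate there meets the convexity
    -- bound on the segment, and dividing by `t` gives the claim.
    obtain ⟨t, ht, ht1, ht0⟩ :=
      ((hlim.eventually (h ε hε)).and (h1.and self_mem_nhdsWithin)).exists
    have ht0 : 0 < t := ht0
    have hpt : x + t • (z - x) = (1 - t) • x + t • z := by module
    have hmem : x + t • (z - x) ∈ C := by
      rw [hpt]; exact hp.1 hx hz (by linarith) ht0.le (by ring)
    have h2 := ht hmem
    have h3 := hp.2 hx hz (show 0 ≤ 1 - t by linarith) ht0.le (by ring)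
    rw [← hpt] at h3
    simp only [add_sub_cancel_left, inner_smul_right, norm_smul, Real.norm_eq_abs,
      abs_of_pos ht0, smul_eq_mul] at h2 h3
    have h4 : t * (p x + inner ℝ v (z - x) - ε * ‖z - x‖) ≤ t * p z := by nlinarith
    exact le_of_mul_le_mul_left h4 ht0
  refine le_of_forall_pos_le_add fun δ hδ => ?_
  have h1 := key (δ / (‖z - x‖ + 1)) (by positivity)
  have h2 : δ / (‖z - x‖ + 1) * ‖z - x‖ ≤ δ := by
    rw [div_mul_eq_mul_div, div_le_iff₀ (by positivity)]
    nlinarith [norm_nonneg (z - x)]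
  linarith

theorem convexSubdiff_of_regularSubdiff {φ : E → EReal} (h : GammaZero φ) {x v : E}
    (hv : v ∈ regularSubdiff φ x) : v ∈ convexSubdiff φ x := by
  obtain ⟨h1, h2, h3⟩ := hv
  refine ⟨h1, h2, fun z => ?_⟩
  have hx : x ∈ dom φ := lt_top_iff_ne_top.2 h1
  by_cases hz : z ∈ dom φ
  · have := subgradient_of_eventually (v := v) h.convexOn hx hz fun ε hε => by
      filter_upwards [h3 ε hε] with y hy hyd
      rw [← h.proper.coe_toReal hyd, ← h.proper.coe_toReal hx] at hy
      norm_cast at hy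
      linarith
    rw [← h.proper.coe_toReal hz, ← h.proper.coe_toReal hx]
    exact_mod_cast this
  · have : φ z = ⊤ := not_lt_top_iff.1 hz
    rw [this]; exact le_top

theorem convexSubdiff_ineq {φ : E → EReal} (h : Proper φ) {x z v : E}
    (hv : v ∈ convexSubdiff φ x) (hz : z ∈ dom φ) :
    (φ x).toReal + inner ℝ v (z - x) ≤ (φ z).toReal := by
  have hx : x ∈ dom φ := lt_top_iff_ne_top.2 hv.1
  have := hv.2.2 z
  rw [← h.coe_toReal hz, ← h.coe_toReal hx] at this
  exact_mod_cast this

variable [CompleteSpace E]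

theorem hasGradientAt_estimate {s : E → ℝ} {v x : E} (h : HasGradientAt s v x) {ε : ℝ}
    (hε : 0 < ε) : ∀ᶠ y in 𝓝 x, |s y - s x - inner ℝ v (y - x)| ≤ ε * ‖y - x‖ := by
  have := (hasGradientAt_iff_isLittleO.1 h).def hε
  simpa [Real.norm_eq_abs] using this

theorem gradient_ineq {C : Set E} {p : E → ℝ} (hp : ConvexOn ℝ C p) {x z v : E}
    (hx : x ∈ C) (hz : z ∈ C) (h : HasGradientAt p v x) : p x + inner ℝ v (z - x) ≤ p z := by
  refine subgradient_of_eventually hp hx hz fun ε hε => ?_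
  filter_upwards [hasGradientAt_estimate h hε] with y hy _
  have := (abs_le.1 hy).1
  linarith

/-- `p - ⟪w, ·⟫` has a local minimum at `x`, so its derivative `v - w` vanishes. -/
theorem eq_of_local_subgradient {p : E → ℝ} {x v w : E} (h : HasGradientAt p v x)
    (hw : ∀ᶠ y in 𝓝 x, p x + inner ℝ w (y - x) ≤ p y) : w = v := by
  have h1 : HasFDerivAt (fun y => p y - innerSL ℝ w y) (innerSL ℝ v - innerSL ℝ w) x :=
    (hasGradientAt_iff_hasFDerivAt.1 h).sub (innerSL ℝ w).hasFDerivAt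
  have h2 : IsLocalMin (fun y => p y - innerSL ℝ w y) x := by
    filter_upwards [hw] with y hy
    simp only [innerSL_apply_apply, inner_sub_right] at hy ⊢
    linarith
  have h3 := h2.hasFDerivAt_eq_zero h1
  have h4 : innerSL ℝ v (v - w) - innerSL ℝ w (v - w) = 0 := by
    rw [← sub_apply, h3]; rfl
  rw [innerSL_apply_apply, innerSL_apply_apply, ← inner_sub_left, inner_self_eq_zero,
    sub_eq_zero] at h4
  exact h4.symm

/-- If `f + s` has a local minimum at `x`, then `-∇s(x)` is a regular subgradient of `f`. -/
theorem neg_gradient_mem_regularSubdiff {f : E → EReal} (hf : Proper f) {s : E → ℝ} {x v : E}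
    (hx : x ∈ dom f) (hs : HasGradientAt s v x)
    (hmin : ∀ᶠ y in 𝓝 x, ∀ c : ℝ, f y = c → (f x).toReal + s x ≤ c + s y) :
    -v ∈ regularSubdiff f x := by
  refine ⟨ne_of_lt hx, (hf.1 x).ne', fun ε hε => ?_⟩
  filter_upwards [hmin, hasGradientAt_estimate hs hε] with y hy hy2
  by_cases hyd : y ∈ dom f
  · rw [← hf.coe_toReal hyd, ← hf.coe_toReal hx]
    have h1 := hy _ (hf.coe_toReal hyd).symm
    have h2 := (abs_le.1 hy2).2
    norm_cast
    rw [inner_neg_left]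
    linarith
  · have : f y = ⊤ := not_lt_top_iff.1 hyd
    rw [this]; exact le_top

theorem Legendre.hasGradientAt {φ : E → EReal} (h : Legendre φ) {x : E}
    (hx : x ∈ interior (dom φ)) :
    HasGradientAt (fun y => (φ y).toReal) (grad φ x) x :=
  (h.smooth.2.1 x hx).hasGradientAt

theorem Legendre.continuousAt_toReal {φ : E → EReal} (h : Legendre φ) {x : E}
    (hx : x ∈ interior (dom φ)) : ContinuousAt (fun y => (φ y).toReal) x :=
  (h.hasGradientAt hx).continuousAt

theorem Legendre.grad_ineq {φ : E → EReal} (h : Legendre φ) {x z : E}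
    (hx : x ∈ interior (dom φ)) (hz : z ∈ dom φ) :
    (φ x).toReal + inner ℝ (grad φ x) (z - x) ≤ (φ z).toReal :=
  gradient_ineq h.gammaZero.convexOn (interior_subset hx) hz (h.hasGradientAt hx)

theorem Legendre.grad_mem_convexSubdiff {φ : E → EReal} (h : Legendre φ) {x : E}
    (hx : x ∈ interior (dom φ)) : grad φ x ∈ convexSubdiff φ x := by
  have hxd := interior_subset hx
  refine ⟨ne_of_lt hxd, (h.gammaZero.proper.1 x).ne', fun z => ?_⟩
  by_cases hz : z ∈ dom φ
  · rw [← h.gammaZero.proper.coe_toReal hz, ← h.gammaZero.proper.coe_toReal hxd]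
    exact_mod_cast h.grad_ineq hx hz
  · have : φ z = ⊤ := not_lt_top_iff.1 hz
    rw [this]; exact le_top

/-- The real-valued Bregman distance on the domain. -/
def bregReal (φ : E → EReal) (x y : E) : ℝ :=
  (φ x).toReal - (φ y).toReal - inner ℝ (grad φ y) (x - y)

theorem bregman_eq_coe {φ : E → EReal} (h : Proper φ) {x y : E} (hx : x ∈ dom φ)
    (hy : y ∈ interior (dom φ)) : bregman φ x y = (bregReal φ x y : EReal) := by
  rw [bregman, if_pos hy, ← h.coe_toReal hx, ← h.coe_toReal (interior_subset hy)]
  rw [bregReal]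
  norm_cast

theorem bregman_eq_top {φ : E → EReal} (h : Proper φ) {x y : E} (hx : x ∉ dom φ) :
    bregman φ x y = ⊤ := by
  by_cases hy : y ∈ interior (dom φ)
  · have hx : φ x = ⊤ := not_lt_top_iff.1 hx
    rw [bregman, if_pos hy, ← h.coe_toReal (interior_subset hy), hx]
    rfl
  · rw [bregman, if_neg hy]

theorem bregman_eq_top' {φ : E → EReal} {x y : E} (hy : y ∉ interior (dom φ)) :
    bregman φ x y = ⊤ := by
  rw [bregman, if_neg hy]

theorem Legendre.bregReal_nonneg {φ : E → EReal} (h : Legendre φ) {x y : E} (hx : x ∈ dom φ)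
    (hy : y ∈ interior (dom φ)) : 0 ≤ bregReal φ x y := by
  have := h.grad_ineq hy hx
  rw [bregReal]; linarith

theorem bregReal_self {φ : E → EReal} (x : E) : bregReal φ x x = 0 := by
  simp [bregReal]

/-- Strict convexity is available only on the interior, whereas `x` may be a boundary point. The
segment is therefore halved first, to an interior `z`. If the distance were nonpositive, strict
convexity between `z` and `y` would push the next midpoint below the tangent at `y`. -/
theorem Legendre.bregReal_pos {φ : E → EReal} (h : Legendre φ) {x y : E} (hx : x ∈ dom φ)
    (hy : y ∈ interior (dom φ)) (hxy : x ≠ y) : 0 < bregReal φ x y := by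
  by_contra! hle
  have hcv := h.gammaZero.convexOn
  have hyd := interior_subset hy
  have hz : (1 / 2 : ℝ) • x + (1 / 2 : ℝ) • y ∈ interior (dom φ) :=
    hcv.1.combo_self_interior_mem_interior hx hy (by norm_num) (by norm_num) (by norm_num)
  set z := (1 / 2 : ℝ) • x + (1 / 2 : ℝ) • y with hzdef
  have hzy : z ≠ y := by
    intro he
    apply hxy
    have : x - y = (2 : ℝ) • (z - y) := by rw [hzdef]; module
    rw [he, sub_self, smul_zero, sub_eq_zero] at this
    exact this
  have h1 := hcv.2 hx hyd (show (0 : ℝ) ≤ 1 / 2 by norm_num) (show (0 : ℝ) ≤ 1 / 2 by norm_num)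
    (by norm_num)
  rw [← hzdef] at h1
  have hst := h.strict (interior (dom φ)) hcv.1.interior
    fun w hw => ⟨_, h.grad_mem_convexSubdiff hw⟩
  have h2 := hst.2 hz hy hzy (show (0 : ℝ) < 1 / 2 by norm_num)
    (show (0 : ℝ) < 1 / 2 by norm_num) (by norm_num)
  have h3 : (1 / 2 : ℝ) • z + (1 / 2 : ℝ) • y ∈ dom φ :=
    hcv.1 (interior_subset hz) hyd (by norm_num) (by norm_num) (by norm_num)
  have h4 := h.grad_ineq hy h3
  have h5 : (1 / 2 : ℝ) • z + (1 / 2 : ℝ) • y - y = (1 / 4 : ℝ) • (x - y) := by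
    rw [hzdef]; module
  rw [h5, inner_smul_right] at h4
  rw [bregReal] at hle
  simp only [smul_eq_mul] at h1 h2
  linarith

end Convex

/-! ### Continuity of the gradient and absence of boundary subgradients -/

section FiniteDim

variable {E : Type*} [NormedAddCommGroup E] [InnerProductSpace ℝ E] [FiniteDimensional ℝ E]
  [CompleteSpace E]

/-- A convex function is locally Lipschitz inside its domain, and the Lipschitz constant bounds the
gradient. -/
theorem Legendre.grad_bounded {φ : E → EReal} (h : Legendre φ) {x : E}
    (hx : x ∈ interior (dom φ)) : ∃ L : ℝ, ∀ᶠ y in 𝓝 x, ‖grad φ y‖ ≤ L := by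
  obtain ⟨K, t, ht, hL⟩ := h.gammaZero.convexOn.locallyLipschitzOn_interior hx
  rw [isOpen_interior.nhdsWithin_eq hx] at ht
  refine ⟨K, ?_⟩
  filter_upwards [eventually_mem_nhds_iff.2 ht, isOpen_interior.mem_nhds hx] with y hy hyi
  have := (hasGradientAt_iff_hasFDerivAt.1 (h.hasGradientAt hyi)).le_of_lipschitzOn hy hL
  simpa using this

/-- Gradients near `x` stay in a compact ball, and any cluster point inherits the subgradient
inequality at `x`, hence is the gradient there. -/
theorem Legendre.continuousAt_grad {φ : E → EReal} (h : Legendre φ) {x : E}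
    (hx : x ∈ interior (dom φ)) : ContinuousAt (grad φ) x := by
  obtain ⟨L, hL⟩ := h.grad_bounded hx
  refine (isCompact_closedBall (0 : E) L).tendsto_nhds_of_unique_mapClusterPt
    (by filter_upwards [hL] with y hy; simpa using hy) ?_
  intro v _ hv
  obtain ⟨U, hU, hUv⟩ := mapClusterPt_iff_ultrafilter.1 hv
  have hUx : Tendsto (fun y : E => y) U (𝓝 x) := hU
  refine eq_of_local_subgradient (h.hasGradientAt hx) ?_
  filter_upwards [isOpen_interior.mem_nhds hx] with z hz
  have h1 : Tendsto (fun y => (φ y).toReal + inner ℝ (grad φ y) (z - y)) U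
      (𝓝 ((φ x).toReal + inner ℝ v (z - x))) :=
    ((h.continuousAt_toReal hx).tendsto.comp hUx).add
      (hUv.inner (tendsto_const_nhds.sub hUx))
  refine le_of_tendsto h1 ?_
  have h2 : ∀ᶠ y in (U : Filter E), y ∈ interior (dom φ) :=
    hU (isOpen_interior.mem_nhds hx)
  filter_upwards [h2] with y hy
  exact h.grad_ineq hy (interior_subset hz)

/-- Subgradients of an essentially smooth function exist only in the interior of its domain. -/
theorem Legendre.mem_interior_of_convexSubdiff {φ : E → EReal} (h : Legendre φ) {x v : E}
    (hv : v ∈ convexSubdiff φ x) : x ∈ interior (dom φ) := by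
  by_contra hxi
  have hxd : x ∈ dom φ := lt_top_iff_ne_top.2 hv.1
  have hfr : x ∈ frontier (dom φ) := ⟨subset_closure hxd, hxi⟩
  obtain ⟨c, hc⟩ := h.smooth.1
  obtain ⟨δ, hδ, hball⟩ := Metric.isOpen_iff.1 isOpen_interior c hc
  have hcv := h.gammaZero.convexOn
  have hprop := h.gammaZero.proper
  -- The boundary point `x` is approached along the segment to an interior point `c`, where
  -- gradients exist and must blow up.
  let t : ℕ → ℝ := fun k => 1 / ((k : ℝ) + 1)
  have ht0 : ∀ k, 0 < t k := fun k => Nat.one_div_pos_of_nat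
  have ht1 : ∀ k, t k ≤ 1 := fun k => by
    rw [div_le_one (by positivity)]; linarith [(Nat.cast_nonneg k : (0 : ℝ) ≤ k)]
  have htl : Tendsto t atTop (𝓝 0) := tendsto_one_div_add_atTop_nhds_zero_nat
  let y : ℕ → E := fun k => x + t k • (c - x)
  have hyi : ∀ k, y k ∈ interior (dom φ) := fun k => by
    have : y k = (1 - t k) • x + t k • c := by simp only [y]; module
    rw [this]
    exact hcv.1.combo_self_interior_mem_interior hxd hc (by linarith [ht1 k]) (ht0 k) (by ring)
  have hyl : Tendsto y atTop (𝓝 x) := by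
    have : Tendsto y atTop (𝓝 (x + (0 : ℝ) • (c - x))) :=
      tendsto_const_nhds.add (htl.smul_const _)
    simpa using this
  have hblow : Tendsto (fun k => ‖grad φ (y k)‖) atTop atTop :=
    (h.smooth.2.2 x hfr).comp
      (tendsto_nhdsWithin_iff.2 ⟨hyl, Eventually.of_forall hyi⟩)
  -- the gradients are bounded below in the direction `c - x`
  have hlow : ∀ k, inner ℝ v (c - x) ≤ inner ℝ (grad φ (y k)) (c - x) := fun k => by
    have h1 := convexSubdiff_ineq hprop hv (interior_subset (hyi k))
    have h2 := h.grad_ineq (hyi k) hxd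
    have e1 : y k - x = t k • (c - x) := by simp only [y]; module
    have e2 : x - y k = -(t k • (c - x)) := by simp only [y]; module
    rw [e1, inner_smul_right] at h1
    rw [e2, inner_neg_right, inner_smul_right] at h2
    exact le_of_mul_le_mul_left (by linarith) (ht0 k)
  -- and blow up to `-∞` in that direction
  obtain ⟨M, hM⟩ : ∃ M : ℝ, ∀ w ∈ Metric.closedBall c (δ / 2), (φ w).toReal ≤ M := by
    have hcont : ContinuousOn (fun w => (φ w).toReal) (Metric.closedBall c (δ / 2)) :=
      fun w hw => (h.continuousAt_toReal
        (hball (Metric.closedBall_subset_ball (half_lt_self hδ) hw))).continuousWithinAt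
    obtain ⟨M, hM⟩ := (isCompact_closedBall c (δ / 2)).bddAbove_image hcont
    exact ⟨M, fun w hw => hM ⟨w, hw, rfl⟩⟩
  -- The gradient inequality is tested at the point of the ball about `c` farthest in the gradient's
  -- own direction, which produces `δ/2 * ‖grad φ (y k)‖`. The lower bound along `c - x` controls
  -- the other inner product, so the gradients stay bounded after all.
  have hup : ∀ k, δ / 2 * ‖grad φ (y k)‖ + inner ℝ v (c - x) * (1 - t k) ≤
      M - (φ x).toReal + ‖v‖ * ‖c - x‖ := fun k => by
    by_cases hg : grad φ (y k) = 0
    · have h1 := convexSubdiff_ineq hprop hv (interior_subset hc)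
      have h2 := hM c (Metric.mem_closedBall_self (by positivity))
      have h3 := abs_le.1 (abs_real_inner_le_norm v (c - x))
      rw [hg, norm_zero, mul_zero, zero_add]
      nlinarith [ht0 k, ht1 k]
    have hgn : 0 < ‖grad φ (y k)‖ := norm_pos_iff.2 hg
    set w := c + (δ / 2 / ‖grad φ (y k)‖) • grad φ (y k) with hw
    have hwm : w ∈ Metric.closedBall c (δ / 2) := by
      rw [mem_closedBall_iff_norm, hw, add_sub_cancel_left, norm_smul, Real.norm_eq_abs,
        abs_of_pos (by positivity), div_mul_cancel₀ _ hgn.ne']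
    have hwd : w ∈ dom φ :=
      interior_subset (hball (Metric.closedBall_subset_ball (half_lt_self hδ) hwm))
    have h1 := h.grad_ineq (hyi k) hwd
    have h2 := hM w hwm
    have h3 := convexSubdiff_ineq hprop hv (interior_subset (hyi k))
    have e1 : w - y k = (1 - t k) • (c - x) + (δ / 2 / ‖grad φ (y k)‖) • grad φ (y k) := by
      simp only [y, hw]; module
    have e2 : y k - x = t k • (c - x) := by simp only [y]; module
    rw [e1, inner_add_right, inner_smul_right, inner_smul_right,
      real_inner_self_eq_norm_sq] at h1
    have e3 : δ / 2 / ‖grad φ (y k)‖ * ‖grad φ (y k)‖ ^ 2 = δ / 2 * ‖grad φ (y k)‖ := by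
      field_simp
    rw [e2, inner_smul_right] at h3
    have h4 := abs_le.1 (abs_real_inner_le_norm v (c - x))
    have h5 := mul_le_mul_of_nonneg_right (hlow k) (sub_nonneg.2 (ht1 k))
    rw [e3] at h1
    nlinarith [ht0 k, ht1 k, mul_nonneg (norm_nonneg v) (norm_nonneg (c - x))]
  have hbd : ∀ k, ‖grad φ (y k)‖ ≤
      (M - (φ x).toReal + ‖v‖ * ‖c - x‖ + ‖v‖ * ‖c - x‖) / (δ / 2) := fun k => by
    rw [le_div_iff₀ (by positivity)]
    have h4 := abs_le.1 (abs_real_inner_le_norm v (c - x))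
    nlinarith [hup k, ht0 k, ht1 k, mul_nonneg (norm_nonneg v) (norm_nonneg (c - x))]
  obtain ⟨k, hk⟩ := (hblow.eventually_gt_atTop _).exists
  exact absurd (hbd k) (not_le.2 hk)

theorem Legendre.eq_grad_of_convexSubdiff {φ : E → EReal} (h : Legendre φ) {x v : E}
    (hv : v ∈ convexSubdiff φ x) : v = grad φ x := by
  have hx := h.mem_interior_of_convexSubdiff hv
  refine eq_of_local_subgradient (h.hasGradientAt hx) ?_
  filter_upwards [isOpen_interior.mem_nhds hx] with y hy
  exact convexSubdiff_ineq h.gammaZero.proper hv (interior_subset hy)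

end FiniteDim

/-! ### Conjugates of super-coercive Legendre functions -/

section Conjugate

variable {E : Type*} [NormedAddCommGroup E]

theorem SuperCoercive.exists_radius {φ : E → EReal} (h : SuperCoercive φ) (M : ℝ) :
    ∃ R : ℝ, 0 < R ∧ ∀ x ∈ dom φ, R ≤ ‖x‖ → ⊥ < φ x → M * ‖x‖ ≤ (φ x).toReal := by
  have h1 := EReal.tendsto_nhds_top_iff_real.1 h M
  rw [eventually_comap] at h1
  obtain ⟨R, hR⟩ := eventually_atTop.1 h1
  -- Radius at least `1` makes `‖x‖` a genuine positive divisor.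
  refine ⟨max R 1, by positivity, fun x hx hxR hb => ?_⟩
  have h2 := hR ‖x‖ ((le_max_left _ _).trans hxR) x rfl
  have h3 : 0 < ‖x‖ := lt_of_lt_of_le one_pos ((le_max_right _ _).trans hxR)
  rw [← EReal.coe_toReal (ne_of_lt hx) hb.ne'] at h2
  rw [← EReal.coe_div] at h2
  have h4 : M < (φ x).toReal / ‖x‖ := by exact_mod_cast h2
  rw [lt_div_iff₀ h3] at h4
  exact h4.le

variable [InnerProductSpace ℝ E]

theorem mem_convexSubdiff_of_forall_dom {φ : E → EReal} (h : Proper φ) {x y : E} (hx : x ∈ dom φ)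
    (hmin : ∀ z ∈ dom φ, (φ x).toReal + inner ℝ y (z - x) ≤ (φ z).toReal) :
    y ∈ convexSubdiff φ x := by
  refine ⟨ne_of_lt hx, (h.1 x).ne', fun z => ?_⟩
  by_cases hz : z ∈ dom φ
  · rw [← h.coe_toReal hz, ← h.coe_toReal hx]
    exact_mod_cast hmin z hz
  · have : φ z = ⊤ := not_lt_top_iff.1 hz
    rw [this]; exact le_top

theorem conj_eq_of_convexSubdiff {φ : E → EReal} (h : Proper φ) {x y : E}
    (hy : y ∈ convexSubdiff φ x) : conj φ y = ((inner ℝ x y - (φ x).toReal : ℝ) : EReal) := by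
  have hx : x ∈ dom φ := lt_top_iff_ne_top.2 hy.1
  refine le_antisymm (iSup_le fun z => ?_) ?_
  · by_cases hz : z ∈ dom φ
    · have h1 := convexSubdiff_ineq h hy hz
      rw [← h.coe_toReal hz]
      rw [inner_sub_right, real_inner_comm z, real_inner_comm x] at h1
      have h2 : inner ℝ z y - (φ z).toReal ≤ inner ℝ x y - (φ x).toReal := by linarith
      exact_mod_cast h2
    · have : φ z = ⊤ := not_lt_top_iff.1 hz
      rw [this, EReal.sub_top]; exact bot_le
  · refine le_trans (le_of_eq ?_) (le_iSup (fun x : E => (((inner ℝ x y : ℝ) : EReal) - φ x)) x)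
    rw [EReal.coe_sub, h.coe_toReal hx]

variable [FiniteDimensional ℝ E]

/-- Every vector is a subgradient of a super-coercive function at some point. -/
theorem exists_convexSubdiff {φ : E → EReal} (h : Proper φ) (hlsc : LowerSemicontinuous φ)
    (hsc : SuperCoercive φ) (y : E) : ∃ x, y ∈ convexSubdiff φ x := by
  obtain ⟨x₀, hx₀⟩ := h.2
  -- Slope `‖y‖ + 1` gives `φ z - ⟪y, z⟫ ≥ ‖z‖` far out. This exceeds the value `c` at `x₀` once
  -- `‖z‖ > |c|`, so a minimizer over the ball of radius `ρ` is global.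
  obtain ⟨R, hR, hRx⟩ := hsc.exists_radius (‖y‖ + 1)
  set c := (φ x₀).toReal - inner ℝ y x₀ with hc
  set ρ := max R (max |c| ‖x₀‖)
  have hlsc' : LowerSemicontinuous fun x => φ x + ((-inner ℝ y x : ℝ) : EReal) := by
    refine hlsc.add' (Continuous.lowerSemicontinuous ?_) fun x => ?_
    · exact continuous_coe_real_ereal.comp (by fun_prop)
    · exact EReal.continuousAt_add (.inr (EReal.coe_ne_bot _)) (.inr (EReal.coe_ne_top _))
  have hx₀K : x₀ ∈ Metric.closedBall (0 : E) ρ := by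
    rw [mem_closedBall_zero_iff]
    exact (le_max_right _ _).trans (le_max_right _ _)
  obtain ⟨x, -, hmin⟩ := LowerSemicontinuousOn.exists_isMinOn ⟨x₀, hx₀K⟩
    (isCompact_closedBall (0 : E) ρ) (hlsc'.lowerSemicontinuousOn _)
  have hmin : ∀ z ∈ Metric.closedBall (0 : E) ρ,
    φ x + ((-inner ℝ y x : ℝ) : EReal) ≤ φ z + ((-inner ℝ y z : ℝ) : EReal) := hmin
  have hxd : x ∈ dom φ := by
    have h1 := hmin x₀ hx₀K
    by_contra hx
    have hx : φ x = ⊤ := not_lt_top_iff.1 hx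
    rw [hx, EReal.top_add_coe, ← h.coe_toReal hx₀, top_le_iff] at h1
    exact EReal.coe_ne_top _ h1
  have hminr : ∀ z ∈ dom φ, z ∈ Metric.closedBall (0 : E) ρ →
      (φ x).toReal - inner ℝ y x ≤ (φ z).toReal - inner ℝ y z := fun z hz hzK => by
    have h1 := hmin z hzK
    rw [← h.coe_toReal hz, ← h.coe_toReal hxd] at h1
    exact_mod_cast h1
  refine ⟨x, mem_convexSubdiff_of_forall_dom h hxd fun z hz => ?_⟩
  rw [inner_sub_right]
  by_cases hzK : z ∈ Metric.closedBall (0 : E) ρ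
  · linarith [hminr z hz hzK]
  · rw [mem_closedBall_zero_iff, not_le] at hzK
    have h1 := hRx z hz ((le_max_left _ _).trans hzK.le) (h.1 z)
    have h2 := hminr x₀ hx₀ hx₀K
    have h3 : |c| < ‖z‖ := ((le_max_left _ _).trans (le_max_right _ _)).trans_lt hzK
    have h4 := le_abs_self c
    have h5 := real_inner_le_norm y z
    linarith

variable [CompleteSpace E]

/-- With `y = ∇φ(z)`, the subgradient inequality from `x` to `z` says `D_φ(x, z) ≤ 0`. -/
theorem Legendre.convexSubdiff_unique {φ : E → EReal} (h : Legendre φ) {x z y : E}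
    (hx : y ∈ convexSubdiff φ x) (hz : y ∈ convexSubdiff φ z) : x = z := by
  by_contra hne
  have hxi := h.mem_interior_of_convexSubdiff hx
  have hzi := h.mem_interior_of_convexSubdiff hz
  have h1 := h.bregReal_pos (interior_subset hxi) hzi hne
  have h2 := convexSubdiff_ineq h.gammaZero.proper hx (interior_subset hzi)
  rw [bregReal, ← h.eq_grad_of_convexSubdiff hz] at h1
  rw [← neg_sub, inner_neg_right] at h2
  linarith

/-- Super-coercivity keeps `X` locally bounded, semicontinuity shows that `y` is a subgradient at
each cluster point, and uniqueness identifies that point. -/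
theorem Legendre.continuous_of_mem_convexSubdiff {φ : E → EReal} (h : Legendre φ)
    (hsc : SuperCoercive φ) {X : E → E} (hX : ∀ y, y ∈ convexSubdiff φ (X y)) :
    Continuous X := by
  have hprop := h.gammaZero.proper
  have hXd : ∀ y, X y ∈ dom φ := fun y => lt_top_iff_ne_top.2 (hX y).1
  refine continuous_iff_continuousAt.2 fun y => ?_
  obtain ⟨x₀, hx₀⟩ := hprop.2
  -- The slope exceeds `‖w‖ ≤ ‖y‖ + 1` by one, so `φ (X w) - ⟪w, X w⟫ ≥ ‖X w‖` far out; comparison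
  -- with `x₀` caps the left side.
  obtain ⟨R, hR, hRx⟩ := hsc.exists_radius (‖y‖ + 2)
  set B := max R ((φ x₀).toReal + (‖y‖ + 1) * ‖x₀‖) with hB
  refine (isCompact_closedBall (0 : E) B).tendsto_nhds_of_unique_mapClusterPt ?_ ?_
  · filter_upwards [Metric.closedBall_mem_nhds y one_pos] with w hw
    rw [mem_closedBall_iff_norm] at hw
    rw [mem_closedBall_zero_iff]
    by_contra! hlt
    have h1 := hRx (X w) (hXd w) ((le_max_left _ _).trans hlt.le) (hprop.1 _)
    have h2 := convexSubdiff_ineq hprop (hX w) hx₀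
    have h3 : ‖w‖ ≤ ‖y‖ + 1 := by
      have := norm_add_le (w - y) y
      rw [sub_add_cancel] at this; linarith
    have h4 := real_inner_le_norm w (X w)
    have h5 := (abs_le.1 (abs_real_inner_le_norm w x₀)).1
    have h6 := (le_max_right R ((φ x₀).toReal + (‖y‖ + 1) * ‖x₀‖)).trans_lt hlt
    rw [inner_sub_right] at h2
    nlinarith [norm_nonneg (X w), norm_nonneg x₀]
  · intro x' _ hcl
    obtain ⟨U, hU, hUx⟩ := mapClusterPt_iff_ultrafilter.1 hcl
    have hUy : Tendsto (fun w : E => w) U (𝓝 y) := hU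
    have hle : ∀ z ∈ dom φ, φ x' ≤ (((φ z).toReal - inner ℝ y (z - x') : ℝ) : EReal) := by
      intro z hz
      refine le_of_lsc_of_tendsto h.gammaZero.lsc hUx
        (tendsto_const_nhds.sub (hUy.inner (tendsto_const_nhds.sub hUx)))
        (Eventually.of_forall fun w => ?_)
      have h2 := convexSubdiff_ineq hprop (hX w) hz
      rw [← hprop.coe_toReal (hXd w)]
      exact_mod_cast (by linarith :
        (φ (X w)).toReal ≤ (φ z).toReal - inner ℝ w (z - X w))
    have hx'd : x' ∈ dom φ := dom_of_le_coe (hle x₀ hx₀)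
    refine h.convexSubdiff_unique (mem_convexSubdiff_of_forall_dom hprop hx'd fun z hz => ?_) (hX y)
    have := hprop.toReal_le (hle z hz)
    linarith

/-- The gradient of the conjugate of a super-coercive Legendre function `φ` inverts `∂φ`. -/
theorem Legendre.conj_spec {φ : E → EReal} (h : Legendre φ) (hsc : SuperCoercive φ) (y : E) :
    y ∈ convexSubdiff φ (grad (conj φ) y) ∧
      HasGradientAt (fun y => (conj φ y).toReal) (grad (conj φ) y) y := by
  have hprop := h.gammaZero.proper
  choose X hX using exists_convexSubdiff hprop h.gammaZero.lsc hsc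
  have hXd : ∀ y, X y ∈ dom φ := fun y => lt_top_iff_ne_top.2 (hX y).1
  have hc : ∀ y, (conj φ y).toReal = inner ℝ (X y) y - (φ (X y)).toReal := fun y => by
    rw [conj_eq_of_convexSubdiff hprop (hX y), EReal.toReal_coe]
  -- The subgradient inequalities at `X y` and `X w` squeeze the linearization error between `0` and
  -- `⟪X w - X y, w - y⟫`, which is `o(‖w - y‖)` by continuity of `X`.
  have hg : HasGradientAt (fun y => (conj φ y).toReal) (X y) y := by
    rw [hasGradientAt_iff_isLittleO, Asymptotics.isLittleO_iff]
    intro ε hε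
    have hcont := (h.continuous_of_mem_convexSubdiff hsc hX).tendsto y
    filter_upwards [hcont.eventually (Metric.ball_mem_nhds (X y) hε)] with w hw
    rw [← Metric.mem_ball, mem_ball_iff_norm] at hw
    have h1 := convexSubdiff_ineq hprop (hX y) (hXd w)
    have h2 := convexSubdiff_ineq hprop (hX w) (hXd y)
    have h3 := real_inner_le_norm (X w - X y) (w - y)
    have h4 : ‖X w - X y‖ * ‖w - y‖ ≤ ε * ‖w - y‖ :=
      mul_le_mul_of_nonneg_right hw.le (norm_nonneg _)
    simp only [hc, Real.norm_eq_abs]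
    simp only [inner_sub_left, inner_sub_right, real_inner_comm (X w), real_inner_comm (X y)]
      at h1 h2 h3 ⊢
    rw [abs_le]
    constructor <;> nlinarith [norm_nonneg (w - y)]
  have he : grad (conj φ) y = X y := hg.gradient
  rw [he]
  exact ⟨hX y, hg⟩

theorem Legendre.grad_conj_mem {φ : E → EReal} (h : Legendre φ) (hsc : SuperCoercive φ) (y : E) :
    grad (conj φ) y ∈ interior (dom φ) :=
  h.mem_interior_of_convexSubdiff (h.conj_spec hsc y).1

theorem Legendre.grad_grad_conj {φ : E → EReal} (h : Legendre φ) (hsc : SuperCoercive φ) (y : E) :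
    grad φ (grad (conj φ) y) = y :=
  (h.eq_grad_of_convexSubdiff (h.conj_spec hsc y).1).symm

theorem Legendre.conj_toReal {φ : E → EReal} (h : Legendre φ) (hsc : SuperCoercive φ) (y : E) :
    (conj φ y).toReal = inner ℝ (grad (conj φ) y) y - (φ (grad (conj φ) y)).toReal := by
  rw [conj_eq_of_convexSubdiff h.gammaZero.proper (h.conj_spec hsc y).1, EReal.toReal_coe]

theorem Legendre.continuous_conj_toReal {φ : E → EReal} (h : Legendre φ) (hsc : SuperCoercive φ) :
    Continuous fun y => (conj φ y).toReal :=
  continuous_iff_continuousAt.2 fun y => (h.conj_spec hsc y).2.continuousAt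

/-- This is the subgradient inequality of `φ` at `∇φ*(w)`, tested at `∇φ*(y)` and rewritten through
Fenchel equality. -/
theorem Legendre.conj_grad_ineq {φ : E → EReal} (h : Legendre φ) (hsc : SuperCoercive φ)
    (y w : E) : (conj φ y).toReal + inner ℝ (grad (conj φ) y) (w - y) ≤ (conj φ w).toReal := by
  rw [h.conj_toReal hsc, h.conj_toReal hsc]
  have h1 := convexSubdiff_ineq h.gammaZero.proper (h.conj_spec hsc w).1
    (interior_subset (h.grad_conj_mem hsc y))
  simp only [inner_sub_right] at h1 ⊢
  rw [real_inner_comm (grad (conj φ) y), real_inner_comm (grad (conj φ) w)] at h1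
  linarith

/-- The splitting isolates the nonsmooth term `φ x` and leaves a coupling differentiable in both
variables. -/
theorem Legendre.bregReal_grad_conj {φ : E → EReal} (h : Legendre φ) (hsc : SuperCoercive φ)
    (x y : E) : bregReal φ x (grad (conj φ) y) =
      (φ x).toReal + ((conj φ y).toReal - inner ℝ y x) := by
  rw [bregReal, h.grad_grad_conj hsc, h.conj_toReal hsc, inner_sub_right,
    real_inner_comm y]
  ring

end Conjugate

/-! ### Weighted sums with independent arguments -/

section WeightedSum

variable {E F : Type*} {f : E → EReal} {φ : F → EReal} {μ : ℝ} {y : E} {z : F}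

theorem add_mul_eq_coe (hf : Proper f) (hφ : Proper φ) (hy : y ∈ dom f) (hz : z ∈ dom φ) (μ : ℝ) :
    f y + (μ : EReal) * φ z = (((f y).toReal + μ * (φ z).toReal : ℝ) : EReal) := by
  rw [EReal.coe_add, EReal.coe_mul, hf.coe_toReal hy, hφ.coe_toReal hz]

theorem mul_ne_bot (hφ : Proper φ) (hμ : 0 < μ) (z : F) : (μ : EReal) * φ z ≠ ⊥ := by
  by_cases hz : z ∈ dom φ
  · rw [← hφ.coe_toReal hz, ← EReal.coe_mul]
    exact EReal.coe_ne_bot _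
  · rw [show φ z = ⊤ from not_lt_top_iff.1 hz, EReal.coe_mul_top_of_pos hμ]
    exact top_ne_bot

theorem mem_dom_of_add_mul_lt_top (hf : Proper f) (hφ : Proper φ) (hμ : 0 < μ)
    (h : f y + (μ : EReal) * φ z < ⊤) : y ∈ dom f ∧ z ∈ dom φ := by
  constructor
  · by_contra hy
    rw [show f y = ⊤ from not_lt_top_iff.1 hy, EReal.top_add_of_ne_bot (mul_ne_bot hφ hμ z)] at h
    exact lt_irrefl _ h
  · by_contra hz
    rw [show φ z = ⊤ from not_lt_top_iff.1 hz, EReal.coe_mul_top_of_pos hμ,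
      EReal.add_top_of_ne_bot (hf.1 y).ne'] at h
    exact lt_irrefl _ h

/-- The two arguments are kept independent because the penalization evaluates `f` and `φ` at
different points. -/
theorem lsc_add_mul [TopologicalSpace E] [TopologicalSpace F] (hf : Proper f) (hφ : Proper φ)
    (hfl : LowerSemicontinuous f) (hφl : LowerSemicontinuous φ) (hμ : 0 < μ) :
    LowerSemicontinuous fun p : E × F => f p.1 + (μ : EReal) * φ p.2 := by
  have hm : LowerSemicontinuous fun z => (μ : EReal) * φ z := by
    refine Continuous.comp_lowerSemicontinuous (g := fun e : EReal => (μ : EReal) * e) ?_ hφl ?_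
    · refine continuous_iff_continuousAt.2 fun e => ?_
      have hμ0 : (μ : EReal) ≠ 0 := by exact_mod_cast hμ.ne'
      exact ContinuousAt.comp (f := fun e : EReal => ((μ : EReal), e))
        (EReal.continuousAt_mul (.inl hμ0) (.inl hμ0)
        (.inl (EReal.coe_ne_bot μ)) (.inl (EReal.coe_ne_top μ)))
        (continuousAt_const.prodMk continuousAt_id)
    · exact fun a b hab => mul_le_mul_of_nonneg_left hab (by exact_mod_cast hμ.le)
  refine (hfl.comp continuous_fst).add' (hm.comp continuous_snd) fun p => ?_
  exact EReal.continuousAt_add (.inr (mul_ne_bot hφ hμ _)) (.inl (hf.1 _).ne')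

/-- Existence of minimizers of `f(y) + μ φ(z) + s(y, z)` over a compact set. -/
theorem exists_min_add_mul [TopologicalSpace E] [TopologicalSpace F] (hf : Proper f)
    (hφ : Proper φ) (hfl : LowerSemicontinuous f) (hφl : LowerSemicontinuous φ) (hμ : 0 < μ)
    {K : Set (E × F)} (hK : IsCompact K) {s : E × F → ℝ} (hs : ContinuousOn s K)
    (hy : y ∈ dom f) (hz : z ∈ dom φ) (hyz : (y, z) ∈ K) :
    ∃ a b, (a, b) ∈ K ∧ a ∈ dom f ∧ b ∈ dom φ ∧ ∀ a' ∈ dom f, ∀ b' ∈ dom φ, (a', b') ∈ K →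
      (f a).toReal + μ * (φ b).toReal + s (a, b) ≤
        (f a').toReal + μ * (φ b').toReal + s (a', b') := by
  have hl : LowerSemicontinuousOn
      (fun p : E × F => (f p.1 + (μ : EReal) * φ p.2) + (s p : EReal)) K := by
    refine ((lsc_add_mul hf hφ hfl hφl hμ).lowerSemicontinuousOn K).add'
      (continuous_coe_real_ereal.comp_continuousOn hs).lowerSemicontinuousOn fun p _ => ?_
    exact EReal.continuousAt_add (.inr (EReal.coe_ne_bot _)) (.inr (EReal.coe_ne_top _))
  obtain ⟨⟨a, b⟩, hab, hmin⟩ := LowerSemicontinuousOn.exists_isMinOn ⟨_, hyz⟩ hK hl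
  have hmin : ∀ p ∈ K, (f a + (μ : EReal) * φ b) + (s (a, b) : EReal) ≤
    (f p.1 + (μ : EReal) * φ p.2) + (s p : EReal) := hmin
  have hlt : f a + (μ : EReal) * φ b < ⊤ := by
    by_contra hnot
    have h1 := hmin _ hyz
    rw [not_lt_top_iff.1 hnot, EReal.top_add_coe] at h1
    simp only [add_mul_eq_coe hf hφ hy hz, ← EReal.coe_add] at h1
    exact EReal.coe_ne_top _ (top_le_iff.1 h1)
  obtain ⟨ha, hb⟩ := mem_dom_of_add_mul_lt_top hf hφ hμ hlt
  refine ⟨a, b, hab, ha, hb, fun a' ha' b' hb' hK' => ?_⟩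
  have h1 := hmin _ hK'
  simp only [add_mul_eq_coe hf hφ ha hb, add_mul_eq_coe hf hφ ha' hb', ← EReal.coe_add] at h1
  exact_mod_cast h1

end WeightedSum

/-! ### Decoupling two functions by a quadratic penalty -/

section Penalization

theorem eventually_toReal_gt {E α : Type*} [TopologicalSpace E] {f : E → EReal} (hf : Proper f)
    (hfl : LowerSemicontinuous f) {x : E} (hx : x ∈ dom f) {l : Filter α} {y : α → E}
    (hy : Tendsto y l (𝓝 x)) (hyd : ∀ j, y j ∈ dom f) {ε : ℝ} (hε : 0 < ε) :
    ∀ᶠ j in l, (f x).toReal - ε < (f (y j)).toReal := by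
  have h1 : (((f x).toReal - ε : ℝ) : EReal) < f x := by
    rw [← hf.coe_toReal hx]
    exact_mod_cast (by simpa using hε : (f x).toReal - ε < (f x).toReal)
  filter_upwards [hy.eventually (hfl x _ h1)] with j hj
  rw [← hf.coe_toReal (hyd j)] at hj
  exact_mod_cast hj

variable {E : Type*} [NormedAddCommGroup E] [InnerProductSpace ℝ E] [FiniteDimensional ℝ E]

/-- Minimizers of `f(y) + μ φ(z) + ρ(y) + ‖y - x‖² + k/2 ‖y - z‖²` near a local minimizer `x` of
`f + μ φ + ρ` converge to `x`, with convergence of the values of `f`. -/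
theorem exists_penalized_minimizers {f φ : E → EReal} (hf : Proper f) (hφ : Proper φ)
    (hfl : LowerSemicontinuous f) (hφl : LowerSemicontinuous φ) {x : E} (hxf : x ∈ dom f)
    (hxφ : x ∈ dom φ) {ρ : E → ℝ} {μ δ : ℝ} (hμ : 0 < μ) (hδ : 0 < δ)
    (hρ : ContinuousOn ρ (Metric.closedBall x δ))
    (hmin : ∀ y ∈ Metric.closedBall x δ, y ∈ dom f → y ∈ dom φ →
      (f x).toReal + μ * (φ x).toReal + ρ x ≤ (f y).toReal + μ * (φ y).toReal + ρ y) :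
    ∃ a b : ℕ → E, (∀ k, a k ∈ dom f) ∧ (∀ k, b k ∈ dom φ) ∧
      Tendsto a atTop (𝓝 x) ∧ Tendsto b atTop (𝓝 x) ∧
      Tendsto (fun k => f (a k)) atTop (𝓝 (f x)) ∧
      ∀ k : ℕ, ∀ a' ∈ dom f, ∀ b' ∈ dom φ, a' ∈ Metric.closedBall x δ →
        b' ∈ Metric.closedBall x δ →
        (f (a k)).toReal + μ * (φ (b k)).toReal +
            (ρ (a k) + ‖a k - x‖ ^ 2 + (k : ℝ) / 2 * ‖a k - b k‖ ^ 2) ≤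
          (f a').toReal + μ * (φ b').toReal + (ρ a' + ‖a' - x‖ ^ 2 + (k : ℝ) / 2 * ‖a' - b'‖ ^ 2) := by
  set B := Metric.closedBall x δ with hB
  have hxB : x ∈ B := Metric.mem_closedBall_self hδ.le
  have hBc : IsCompact B := isCompact_closedBall x δ
  have hex : ∀ k : ℕ, ∃ a b, (a, b) ∈ B ×ˢ B ∧ a ∈ dom f ∧ b ∈ dom φ ∧
      ∀ a' ∈ dom f, ∀ b' ∈ dom φ, (a', b') ∈ B ×ˢ B →
      (f a).toReal + μ * (φ b).toReal + (ρ a + ‖a - x‖ ^ 2 + (k : ℝ) / 2 * ‖a - b‖ ^ 2) ≤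
        (f a').toReal + μ * (φ b').toReal +
          (ρ a' + ‖a' - x‖ ^ 2 + (k : ℝ) / 2 * ‖a' - b'‖ ^ 2) := fun k =>
    exists_min_add_mul hf hφ hfl hφl hμ (hBc.prod hBc)
      (s := fun p : E × E => ρ p.1 + ‖p.1 - x‖ ^ 2 + (k : ℝ) / 2 * ‖p.1 - p.2‖ ^ 2)
      (((hρ.comp continuousOn_fst fun p hp => hp.1).add (by fun_prop)).add (by fun_prop))
      hxf hxφ ⟨hxB, hxB⟩
  choose a b hab ha hb hk using hex
  -- Comparison with the pair `(x, x)`, where both quadratic terms vanish.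
  have hV : ∀ k : ℕ, (f (a k)).toReal + μ * (φ (b k)).toReal +
      (ρ (a k) + ‖a k - x‖ ^ 2 + (k : ℝ) / 2 * ‖a k - b k‖ ^ 2) ≤
      (f x).toReal + μ * (φ x).toReal + ρ x := fun k => by
    have := hk k x hxf x hxφ ⟨hxB, hxB⟩
    simpa using this
  obtain ⟨cf, hcf⟩ := exists_lower_bound hf.1 hfl hBc
  obtain ⟨cφ, hcφ⟩ := exists_lower_bound hφ.1 hφl hBc
  obtain ⟨cρ, hcρ⟩ := hBc.bddBelow_image hρ
  have hcf' : ∀ k, cf ≤ (f (a k)).toReal := fun k => by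
    have := hcf _ (hab k).1
    rw [← hf.coe_toReal (ha k)] at this; exact_mod_cast this
  have hcφ' : ∀ k, cφ ≤ (φ (b k)).toReal := fun k => by
    have := hcφ _ (hab k).2
    rw [← hφ.coe_toReal (hb k)] at this; exact_mod_cast this
  have hcρ' : ∀ k, cρ ≤ ρ (a k) := fun k => hcρ ⟨_, (hab k).1, rfl⟩
  -- What the lower bounds on the ball leave for the penalty; hence `‖a k - b k‖² ≤ 2C/k`.
  set C := (f x).toReal + μ * (φ x).toReal + ρ x - cf - μ * cφ - cρ with hC
  have hsq : ∀ k : ℕ, (k : ℝ) / 2 * ‖a k - b k‖ ^ 2 ≤ C := fun k => by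
    have h1 := mul_le_mul_of_nonneg_left (hcφ' k) hμ.le
    linarith [hV k, hcf' k, hcρ' k, sq_nonneg ‖a k - x‖]
  have hdiff : Tendsto (fun k => a k - b k) atTop (𝓝 0) := by
    rw [tendsto_zero_iff_norm_tendsto_zero]
    have h1 : Tendsto (fun k : ℕ => 2 * C / (k : ℝ)) atTop (𝓝 0) :=
      tendsto_const_div_atTop_nhds_zero_nat _
    have h2 : Tendsto (fun k => ‖a k - b k‖ ^ 2) atTop (𝓝 0) := by
      refine squeeze_zero' (Eventually.of_forall fun k => sq_nonneg _) ?_ h1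
      filter_upwards [eventually_gt_atTop 0] with k hk0
      have : (0 : ℝ) < k := by exact_mod_cast hk0
      rw [le_div_iff₀ this]
      linarith [hsq k]
    have h3 := h2.sqrt
    simpa [Real.sqrt_sq (norm_nonneg _)] using h3
  -- A cluster point `w` of `a` is also one of `b`, and in the limit its value plus `‖w - x‖²` is at
  -- most the value at `x`. Minimality of `x` then forces `w = x`; this is the role of the extra
  -- square.
  have hal : Tendsto a atTop (𝓝 x) := by
    refine hBc.tendsto_nhds_of_unique_mapClusterPt (Eventually.of_forall fun k => (hab k).1) ?_
    intro w hw hcl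
    obtain ⟨U, hU, hUw⟩ := mapClusterPt_iff_ultrafilter.1 hcl
    have hUb : Tendsto b U (𝓝 w) := by
      have := hUw.sub (hdiff.mono_left hU)
      simpa using this
    have hBU : ∀ᶠ k in (U : Filter ℕ), a k ∈ B := Eventually.of_forall fun k => (hab k).1
    have hρU : Tendsto (fun k => ρ (a k)) U (𝓝 (ρ w)) :=
      (hρ w hw).tendsto.comp (tendsto_nhdsWithin_iff.2 ⟨hUw, hBU⟩)
    have hle : f w + (μ : EReal) * φ w ≤
        (((f x).toReal + μ * (φ x).toReal + ρ x - ρ w - ‖w - x‖ ^ 2 : ℝ) : EReal) := by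
      refine le_of_lsc_of_tendsto (lsc_add_mul hf hφ hfl hφl hμ) (hUw.prodMk_nhds hUb)
        ((tendsto_const_nhds.sub hρU).sub ((hUw.sub_const x).norm.pow 2))
        (Eventually.of_forall fun k => ?_)
      simp only [add_mul_eq_coe hf hφ (ha k) (hb k)]
      have h1 := hV k
      have h2 : 0 ≤ (k : ℝ) / 2 * ‖a k - b k‖ ^ 2 := by positivity
      exact_mod_cast (by linarith : (f (a k)).toReal + μ * (φ (b k)).toReal ≤
        (f x).toReal + μ * (φ x).toReal + ρ x - ρ (a k) - ‖a k - x‖ ^ 2)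
    obtain ⟨hwf, hwφ⟩ := mem_dom_of_add_mul_lt_top hf hφ hμ (hle.trans_lt (EReal.coe_lt_top _))
    rw [add_mul_eq_coe hf hφ hwf hwφ] at hle
    have hle : (f w).toReal + μ * (φ w).toReal ≤
      (f x).toReal + μ * (φ x).toReal + ρ x - ρ w - ‖w - x‖ ^ 2 := by exact_mod_cast hle
    have h1 := hmin w hw hwf hwφ
    have h2 : ‖w - x‖ ^ 2 ≤ 0 := by linarith
    have h3 : ‖w - x‖ = 0 := by
      have := sq_nonneg ‖w - x‖
      exact pow_eq_zero_iff two_ne_zero |>.1 (le_antisymm h2 this)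
    exact sub_eq_zero.1 (norm_eq_zero.1 h3)
  have hbl : Tendsto b atTop (𝓝 x) := by simpa using hal.sub hdiff
  have hρl : Tendsto (fun k => ρ (a k)) atTop (𝓝 (ρ x)) :=
    (hρ x hxB).tendsto.comp (tendsto_nhdsWithin_iff.2 ⟨hal, Eventually.of_forall fun k => (hab k).1⟩)
  -- Semicontinuity prevents `f (a k)` from dropping. It cannot rise either, since the sum is capped
  -- by `hV` while `φ (b k)` and `ρ (a k)` cannot drop by more than their shares of `ε`.
  have hfal : Tendsto (fun k => (f (a k)).toReal) atTop (𝓝 (f x).toReal) := by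
    rw [Metric.tendsto_atTop']
    suffices h : ∀ ε > 0, ∀ᶠ k in atTop, dist (f (a k)).toReal (f x).toReal < ε by
      intro ε hε
      obtain ⟨N, hN⟩ := eventually_atTop.1 (h ε hε)
      exact ⟨N, fun k hk => hN k hk.le⟩
    intro ε hε
    have hε4 : 0 < ε / (4 * μ) := by positivity
    filter_upwards [eventually_toReal_gt hf hfl hxf hal ha hε,
      eventually_toReal_gt hφ hφl hxφ hbl hb hε4,
      hρl.eventually (lt_mem_nhds (show ρ x - ε / 2 < ρ x by linarith))] with k h1 h2 h3
    rw [Real.dist_eq, abs_lt]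
    refine ⟨by linarith, ?_⟩
    have h4 := hV k
    have h5 : 0 ≤ (k : ℝ) / 2 * ‖a k - b k‖ ^ 2 := by positivity
    have h6 := mul_lt_mul_of_pos_left h2 hμ
    have h7 : μ * (ε / (4 * μ)) = ε / 4 := by field_simp
    rw [mul_sub, h7] at h6
    linarith [sq_nonneg ‖a k - x‖]
  refine ⟨a, b, ha, hb, hal, hbl, ?_, fun k a' ha' b' hb' h1 h2 => hk k a' ha' b' hb' ⟨h1, h2⟩⟩
  have := (continuous_coe_real_ereal.tendsto _).comp hfal
  rw [hf.coe_toReal hxf] at this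
  refine this.congr fun k => ?_
  exact hf.coe_toReal (ha k)

end Penalization

/-! ### Interiority from the constraint qualification -/

section Qualified

variable {E : Type*} [NormedAddCommGroup E] [InnerProductSpace ℝ E] [CompleteSpace E]

theorem hasGradientAt_norm_sq (c a : E) :
    HasGradientAt (fun y => ‖y - c‖ ^ 2) ((2 : ℝ) • (a - c)) a := by
  rw [hasGradientAt_iff_hasFDerivAt]
  refine (((hasFDerivAt_id a).sub_const c).norm_sq).congr_fderiv ?_
  ext w
  simp [two_smul]

theorem hasGradientAt_add {s t : E → ℝ} {v w x : E} (hs : HasGradientAt s v x)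
    (ht : HasGradientAt t w x) : HasGradientAt (fun y => s y + t y) (v + w) x := by
  rw [hasGradientAt_iff_hasFDerivAt] at *
  rw [map_add]; exact hs.add ht

theorem hasGradientAt_const_mul {s : E → ℝ} {v x : E} (hs : HasGradientAt s v x) (c : ℝ) :
    HasGradientAt (fun y => c * s y) (c • v) x := by
  rw [hasGradientAt_iff_hasFDerivAt] at *
  rw [map_smulₛₗ]; exact hs.const_mul c

variable [FiniteDimensional ℝ E]

/-- Under the constraint qualification, a local minimizer of `f + μ φ + ρ` with `ρ` smooth lies in
the interior of the domain of the Legendre function `φ`. -/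
theorem mem_interior_of_qualified_min {f φ : E → EReal} (hf : Proper f) (hφ : Legendre φ)
    (hfl : LowerSemicontinuous f) {x : E} (hxf : x ∈ dom f) (hxφ : x ∈ dom φ)
    (hCQ : horizonSubdiff f x ∩ {v | -v ∈ normalCone (dom φ) x} = {0})
    {ρ : E → ℝ} {gρ : E → E} {μ δ L : ℝ} (hμ : 0 < μ) (hδ : 0 < δ)
    (hρ : ∀ y ∈ Metric.closedBall x δ, HasGradientAt ρ (gρ y) y)
    (hL : ∀ y ∈ Metric.closedBall x δ, ‖gρ y‖ ≤ L)
    (hmin : ∀ y ∈ Metric.closedBall x δ, y ∈ dom f → y ∈ dom φ →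
      (f x).toReal + μ * (φ x).toReal + ρ x ≤ (f y).toReal + μ * (φ y).toReal + ρ y) :
    x ∈ interior (dom φ) := by
  have hφp := hφ.gammaZero.proper
  obtain ⟨a, b, ha, hb, hal, hbl, hfal, hk⟩ := exists_penalized_minimizers hf hφp hfl
    hφ.gammaZero.lsc hxf hxφ hμ hδ
    (fun y hy => (hρ y hy).continuousAt.continuousWithinAt) hmin
  -- `p k` is the approximate multiplier of the constraint `y = z`; `e k` collects the gradients of
  -- the remaining smooth terms and stays bounded.
  set p : ℕ → E := fun k => (k : ℝ) • (a k - b k) with hp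
  set e : ℕ → E := fun k => gρ (a k) + (2 : ℝ) • (a k - x) with he
  have hball : ∀ᶠ k in atTop, a k ∈ Metric.ball x δ ∧ b k ∈ Metric.ball x δ :=
    (hal.eventually (Metric.ball_mem_nhds x hδ)).and (hbl.eventually (Metric.ball_mem_nhds x hδ))
  -- stationarity in the first variable
  have hw : ∀ᶠ k in atTop, -(e k + p k) ∈ regularSubdiff f (a k) := by
    filter_upwards [hball] with k hkb
    have hs : HasGradientAt (fun y => (ρ y + ‖y - x‖ ^ 2) + (k : ℝ) / 2 * ‖y - b k‖ ^ 2)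
        (e k + p k) (a k) := by
      have h1 := hasGradientAt_add (hasGradientAt_add (hρ (a k) (Metric.ball_subset_closedBall hkb.1))
        (hasGradientAt_norm_sq x (a k)))
        (hasGradientAt_const_mul (hasGradientAt_norm_sq (b k) (a k)) ((k : ℝ) / 2))
      convert h1 using 2
      simp only [hp]; module
    refine neg_gradient_mem_regularSubdiff hf (ha k) hs ?_
    filter_upwards [Metric.isOpen_ball.mem_nhds hkb.1] with y hy c hc
    have hyd : y ∈ dom f := dom_of_le_coe hc.le
    have h1 := hk k y hyd (b k) (hb k) (Metric.ball_subset_closedBall hy)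
      (Metric.ball_subset_closedBall hkb.2)
    rw [hc, EReal.toReal_coe] at h1
    linarith
  -- stationarity in the second variable
  have hv : ∀ᶠ k in atTop, (1 / μ) • p k ∈ convexSubdiff φ (b k) := by
    filter_upwards [hball] with k hkb
    apply convexSubdiff_of_regularSubdiff hφ.gammaZero
    have hs := hasGradientAt_const_mul (hasGradientAt_norm_sq (a k) (b k)) ((k : ℝ) / 2 / μ)
    have e1 : (1 / μ) • p k = -(((k : ℝ) / 2 / μ) • (2 : ℝ) • (b k - a k)) := by
      simp only [hp]; module
    rw [e1]
    refine neg_gradient_mem_regularSubdiff hφp (hb k) hs ?_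
    filter_upwards [Metric.isOpen_ball.mem_nhds hkb.2] with y hy c hc
    have hyd : y ∈ dom φ := dom_of_le_coe hc.le
    have h1 := hk k (a k) (ha k) y hyd (Metric.ball_subset_closedBall hkb.1)
      (Metric.ball_subset_closedBall hy)
    rw [hc, EReal.toReal_coe, norm_sub_rev (a k) y, norm_sub_rev (a k) (b k)] at h1
    have e2 : ∀ r : ℝ, (k : ℝ) / 2 / μ * r = ((k : ℝ) / 2 * r) / μ := fun r => by ring
    rw [e2, e2, ← mul_le_mul_iff_of_pos_left hμ, mul_add, mul_add, mul_div_cancel₀ _ hμ.ne',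
      mul_div_cancel₀ _ hμ.ne']
    linarith
  by_cases hT : Tendsto (fun k => ‖p k‖) atTop atTop
  -- Unbounded multipliers: a unit cluster direction `d` of `p` is normal to `dom φ` at `x`, while
  -- `-d` is a horizon subgradient of `f`, as scaling by `1/‖p‖` eliminates `e`.
  · exfalso
    -- Shifting by `N` turns the eventual facts into facts for every index, as the definition of
    -- horizon subgradients demands.
    obtain ⟨N, hN⟩ := eventually_atTop.1
      (((hball.and hw).and hv).and (hT.eventually_gt_atTop 0))
    obtain ⟨d, hd, θ, hθ, hθl⟩ := (isCompact_sphere (0 : E) 1).tendsto_subseq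
      (x := fun k => (1 / ‖p (k + N)‖) • p (k + N)) (fun k => by
        have h0 : 0 < ‖p (k + N)‖ := (hN (k + N) (Nat.le_add_left _ _)).2
        rw [mem_sphere_zero_iff_norm, norm_smul, Real.norm_eq_abs, abs_of_pos (by positivity),
          one_div_mul_cancel h0.ne'])
    set s : ℕ → ℕ := fun j => θ j + N with hs
    have hsl : Tendsto s atTop atTop := (tendsto_add_atTop_nat N).comp hθ.tendsto_atTop
    have hsN : ∀ j, ((a (s j) ∈ Metric.ball x δ ∧ b (s j) ∈ Metric.ball x δ) ∧
        -(e (s j) + p (s j)) ∈ regularSubdiff f (a (s j))) ∧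
        (1 / μ) • p (s j) ∈ convexSubdiff φ (b (s j)) := fun j => (hN _ (Nat.le_add_left _ _)).1
    have hs0 : ∀ j, 0 < ‖p (s j)‖ := fun j => (hN _ (Nat.le_add_left _ _)).2
    have hc0 : Tendsto (fun j => 1 / ‖p (s j)‖) atTop (𝓝 0) := by
      simp only [one_div]
      exact (hT.comp hsl).inv_tendsto_atTop
    have hq : Tendsto (fun j => (1 / ‖p (s j)‖) • p (s j)) atTop (𝓝 d) := hθl
    have hbs : Tendsto (fun j => b (s j)) atTop (𝓝 x) := hbl.comp hsl
    -- Dividing the subgradient inequality of `φ` at `b` by the multiplier norm removes the function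
    -- values, because `φ (b ·)` is bounded below.
    have hnormal : d ∈ regularNormalCone (dom φ) x := by
      refine ⟨hxφ, fun ε hε => ?_⟩
      filter_upwards [self_mem_nhdsWithin] with z hz
      obtain ⟨cφ, hcφ⟩ := exists_lower_bound hφp.1 hφ.gammaZero.lsc (isCompact_closedBall x δ)
      have h1 : inner ℝ d (z - x) ≤ 0 * (μ * ((φ z).toReal - cφ)) := by
        refine le_of_tendsto_of_tendsto' (hq.inner (tendsto_const_nhds.sub hbs))
          (hc0.mul_const _) fun j => ?_
        have h2 := convexSubdiff_ineq hφp (hsN j).2 hz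
        have h3 := hcφ _ (Metric.ball_subset_closedBall (hsN j).1.1.2)
        rw [← hφp.coe_toReal (hb (s j))] at h3
        have h3 : cφ ≤ (φ (b (s j))).toReal := by exact_mod_cast h3
        rw [inner_smul_left] at h2 ⊢
        simp only [RCLike.conj_to_real] at h2 ⊢
        refine mul_le_mul_of_nonneg_left ?_ (by positivity)
        have h4 : 1 / μ * inner ℝ (p (s j)) (z - b (s j)) ≤ (φ z).toReal - cφ := by linarith
        rwa [one_div, inv_mul_le_iff₀ hμ] at h4
      have h2 : 0 ≤ ε * ‖z - x‖ := by positivity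
      linarith
    have hhor : -d ∈ horizonSubdiff f x := by
      refine ⟨ne_of_lt hxf, (hf.1 x).ne', fun j => a (s j), fun j => -(e (s j) + p (s j)),
        fun j => 1 / ‖p (s j)‖, hal.comp hsl, hfal.comp hsl, fun j => (hsN j).1.2,
        fun j => one_div_pos.2 (hs0 j), hc0, ?_⟩
      have hebd : ∀ j, ‖e (s j)‖ ≤ L + 2 * δ := fun j => by
        have h1 := hL _ (Metric.ball_subset_closedBall (hsN j).1.1.1)
        have h2 := mem_ball_iff_norm.1 (hsN j).1.1.1
        refine (norm_add_le _ _).trans (add_le_add h1 ?_)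
        rw [norm_smul, Real.norm_ofNat]
        linarith
      have he0 : Tendsto (fun j => (1 / ‖p (s j)‖) • e (s j)) atTop (𝓝 0) := by
        rw [tendsto_zero_iff_norm_tendsto_zero]
        refine squeeze_zero (fun j => norm_nonneg _) (fun j => ?_)
          (g := fun j => 1 / ‖p (s j)‖ * (L + 2 * δ))
          (by simpa only [zero_mul] using hc0.mul_const (L + 2 * δ))
        rw [norm_smul, Real.norm_eq_abs, abs_of_pos (one_div_pos.2 (hs0 j))]
        exact mul_le_mul_of_nonneg_left (hebd j) (one_div_pos.2 (hs0 j)).le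
      have := (he0.add hq).neg
      rw [zero_add] at this
      refine this.congr fun j => ?_
      simp only [smul_neg, ← smul_add]
    have hmem : -d ∈ horizonSubdiff f x ∩ {v | -v ∈ normalCone (dom φ) x} := by
      refine ⟨hhor, ?_⟩
      change -(-d) ∈ normalCone (dom φ) x
      rw [neg_neg]
      exact ⟨hxφ, fun _ => x, fun _ => d, tendsto_const_nhds, fun _ => hnormal, tendsto_const_nhds⟩
    rw [hCQ, Set.mem_singleton_iff, neg_eq_zero] at hmem
    rw [mem_sphere_zero_iff_norm, hmem, norm_zero] at hd
    exact zero_ne_one hd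
  -- Multipliers bounded along a subsequence: a limit `q` makes `q/μ` a subgradient of `φ` at `x`,
  -- which is impossible on the boundary.
  · obtain ⟨M, hM⟩ : ∃ M : ℝ, ∃ᶠ k in atTop, ‖p k‖ ≤ M := by
      by_contra! hcon
      refine hT (tendsto_atTop.2 fun M => ?_)
      filter_upwards [hcon M] with k hk'
      exact hk'.le
    obtain ⟨s, hs, hsM⟩ := extraction_of_frequently_atTop hM
    obtain ⟨q, -, θ, hθ, hθl⟩ := (isCompact_closedBall (0 : E) M).tendsto_subseq
      (x := fun k => p (s k)) (fun k => by simpa using hsM k)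
    have hsl : Tendsto (fun j => s (θ j)) atTop atTop :=
      hs.tendsto_atTop.comp hθ.tendsto_atTop
    refine hφ.mem_interior_of_convexSubdiff (v := (1 / μ) • q)
      (mem_convexSubdiff_of_forall_dom hφp hxφ fun z hz => ?_)
    have h1 : φ x ≤ (((φ z).toReal - inner ℝ ((1 / μ) • q) (z - x) : ℝ) : EReal) := by
      refine le_of_lsc_of_tendsto hφ.gammaZero.lsc (hbl.comp hsl)
        (tendsto_const_nhds.sub ((hθl.const_smul (1 / μ)).inner
          (tendsto_const_nhds.sub (hbl.comp hsl)))) ?_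
      filter_upwards [hsl.eventually hv] with j hj
      have h2 := convexSubdiff_ineq hφp hj hz
      simp only [Function.comp_apply]
      rw [← hφp.coe_toReal (hb _)]
      exact_mod_cast (by linarith : (φ (b (s (θ j)))).toReal ≤
        (φ z).toReal - inner ℝ ((1 / μ) • p (s (θ j))) (z - b (s (θ j))))
    have := hφp.toReal_le h1
    linarith

end Qualified

/-! ### Limits under vanishing Bregman distance -/

section BregmanLimits

variable {E : Type*} [NormedAddCommGroup E] [InnerProductSpace ℝ E] [FiniteDimensional ℝ E]
  [CompleteSpace E]

theorem Legendre.tendsto_bregReal_right {σ : E → EReal} (h : Legendre σ) {α : Type*}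
    {l : Filter α} {y : α → E} {x : E} (hx : x ∈ interior (dom σ)) (hy : Tendsto y l (𝓝 x))
    (z : E) : Tendsto (fun j => bregReal σ z (y j)) l (𝓝 (bregReal σ z x)) :=
  (tendsto_const_nhds.sub ((h.continuousAt_toReal hx).tendsto.comp hy)).sub
    (((h.continuousAt_grad hx).tendsto.comp hy).inner (tendsto_const_nhds.sub hy))

/-- Points at vanishing Bregman distance have the same limit. -/
theorem Legendre.eq_of_tendsto_bregReal_zero {σ : E → EReal} (h : Legendre σ) {α : Type*}
    {l : Filter α} [l.NeBot] {y z : α → E} {x w : E} (hx : x ∈ interior (dom σ))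
    (hy : Tendsto y l (𝓝 x)) (hz : Tendsto z l (𝓝 w)) (hzd : ∀ j, z j ∈ dom σ)
    (h0 : Tendsto (fun j => bregReal σ (z j) (y j)) l (𝓝 0)) : w = x := by
  -- Solving the distance for `σ (z j)` and using semicontinuity gives `D_σ(w, x) ≤ 0`. Finiteness
  -- of `σ w` comes out of the same bound.
  have hle : σ w ≤ ((0 + (σ x).toReal + inner ℝ (grad σ x) (w - x) : ℝ) : EReal) := by
    refine le_of_lsc_of_tendsto h.gammaZero.lsc hz
      ((h0.add ((h.continuousAt_toReal hx).tendsto.comp hy)).add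
        (((h.continuousAt_grad hx).tendsto.comp hy).inner (hz.sub hy)))
      (Eventually.of_forall fun j => ?_)
    rw [← h.gammaZero.proper.coe_toReal (hzd j)]
    simp only [Function.comp_apply, bregReal]
    exact_mod_cast (by linarith : (σ (z j)).toReal ≤ ((σ (z j)).toReal - (σ (y j)).toReal -
      inner ℝ (grad σ (y j)) (z j - y j)) + (σ (y j)).toReal +
      inner ℝ (grad σ (y j)) (z j - y j))
  by_contra hne
  have h1 := h.bregReal_pos (dom_of_le_coe hle) hx hne
  have h2 := h.gammaZero.proper.toReal_le hle
  rw [bregReal] at h1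
  linarith

end BregmanLimits

/-- `a` is antitone and bounded below, hence convergent, and `d t` is at most the difference of
consecutive terms. -/
theorem tendsto_zero_of_telescoping {a d : ℕ → ℝ} {c : ℝ} (hd : ∀ t, 0 ≤ d t)
    (hc : ∀ t, c ≤ a t) (h : ∀ t, a (t + 1) + d t ≤ a t) : Tendsto d atTop (𝓝 0) := by
  have hanti : Antitone a := antitone_nat_of_succ_le fun t => by linarith [h t, hd t]
  have hlim := tendsto_atTop_ciInf hanti ⟨c, by rintro _ ⟨t, rfl⟩; exact hc t⟩
  have h1 := hlim.sub (hlim.comp (tendsto_add_atTop_nat 1))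
  rw [sub_self] at h1
  exact squeeze_zero hd (fun t => by have := h t; simp only [Function.comp_apply]; linarith) h1

/-! ### The objective, descent along a run, and limits of the subproblems -/

section Objective

variable {n m : ℕ} {φ f : Euc m → EReal} {g : Euc n → EReal} {A : Euc n →ₗ[ℝ] Euc m} {lam : ℝ}

theorem objective_eq (hφ : Legendre φ) (hsc : SuperCoercive φ) (hf : Proper f)
    (hlam : 0 < lam) (u : Euc n) (x : Euc m) :
    objective φ f g A lam (pair u x) = f x + ((1 / lam : ℝ) : EReal) * φ x +
      ((1 / lam * ((conj φ (A u)).toReal - inner ℝ (A u) x) : ℝ) : EReal) + g u := by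
  have hμ : 0 < 1 / lam := one_div_pos.2 hlam
  have hφp := hφ.gammaZero.proper
  change f x + ((1 / lam : ℝ) : EReal) * bregman φ x (grad (conj φ) (A u)) + g u = _
  by_cases hx : x ∈ dom φ
  · rw [bregman_eq_coe hφp hx (hφ.grad_conj_mem hsc _), hφ.bregReal_grad_conj hsc,
      ← EReal.coe_mul, mul_add]
    conv_rhs => rw [← hφp.coe_toReal hx, ← EReal.coe_mul, add_assoc (f x), ← EReal.coe_add]
  · rw [bregman_eq_top hφp hx, show φ x = ⊤ from not_lt_top_iff.1 hx,
      EReal.coe_mul_top_of_pos hμ, EReal.add_top_of_ne_bot (hf.1 x).ne', EReal.top_add_coe]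

/-- The objective as a real-valued function on its domain. -/
def objReal (φ f : Euc m → EReal) (g : Euc n → EReal) (A : Euc n →ₗ[ℝ] Euc m) (lam : ℝ)
    (u : Euc n) (x : Euc m) : ℝ :=
  (f x).toReal + 1 / lam * (φ x).toReal +
    1 / lam * ((conj φ (A u)).toReal - inner ℝ (A u) x) + (g u).toReal

theorem objective_eq_coe (hφ : Legendre φ) (hsc : SuperCoercive φ) (hf : Proper f)
    (hg : Proper g) (hlam : 0 < lam) {u : Euc n} {x : Euc m} (hxf : x ∈ dom f) (hxφ : x ∈ dom φ)
    (hu : u ∈ dom g) :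
    objective φ f g A lam (pair u x) = (objReal φ f g A lam u x : EReal) := by
  rw [objective_eq hφ hsc hf hlam, add_mul_eq_coe hf hφ.gammaZero.proper hxf hxφ,
    ← EReal.coe_add, ← hg.coe_toReal hu, ← EReal.coe_add, objReal]

theorem objective_mem_of_lt_top (hφ : Legendre φ) (hsc : SuperCoercive φ) (hf : Proper f)
    (hg : Proper g) (hlam : 0 < lam) {u : Euc n} {x : Euc m}
    (h : objective φ f g A lam (pair u x) < ⊤) : x ∈ dom f ∧ x ∈ dom φ ∧ u ∈ dom g := by
  have hμ : 0 < 1 / lam := one_div_pos.2 hlam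
  have hφp := hφ.gammaZero.proper
  rw [objective_eq hφ hsc hf hlam] at h
  have h1 : f x + ((1 / lam : ℝ) : EReal) * φ x < ⊤ := by
    by_contra hnot
    rw [not_lt_top_iff.1 hnot, EReal.top_add_coe, EReal.top_add_of_ne_bot (hg.1 u).ne'] at h
    exact lt_irrefl _ h
  obtain ⟨hxf, hxφ⟩ := mem_dom_of_add_mul_lt_top hf hφp hμ h1
  refine ⟨hxf, hxφ, ?_⟩
  by_contra hu
  rw [add_mul_eq_coe hf hφp hxf hxφ, ← EReal.coe_add, show g u = ⊤ from not_lt_top_iff.1 hu,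
    EReal.coe_add_top] at h
  exact lt_irrefl _ h

theorem objective_ge (hφ : Legendre φ) (hsc : SuperCoercive φ) (hf : Proper f)
    (hg : Proper g) (hlam : 0 < lam) {u : Euc n} {x : Euc m} {c : ℝ}
    (h : x ∈ dom f → x ∈ dom φ → u ∈ dom g → c ≤ objReal φ f g A lam u x) :
    (c : EReal) ≤ objective φ f g A lam (pair u x) := by
  by_cases hlt : objective φ f g A lam (pair u x) < ⊤
  · obtain ⟨h1, h2, h3⟩ := objective_mem_of_lt_top hφ hsc hf hg hlam hlt
    rw [objective_eq_coe hφ hsc hf hg hlam h1 h2 h3]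
    exact_mod_cast h h1 h2 h3
  · rw [not_lt_top_iff.1 hlt]; exact le_top

theorem norm_fst_le_pair (u : Euc n) (x : Euc m) : ‖u‖ ≤ ‖pair u x‖ :=
  WithLp.norm_fst_le _ (pair u x)

theorem norm_snd_le_pair (u : Euc n) (x : Euc m) : ‖x‖ ≤ ‖pair u x‖ :=
  WithLp.norm_snd_le _ (pair u x)

theorem Coercive.exists_radius (hcoer : Coercive (objective φ f g A lam)) (hφ : Legendre φ)
    (hsc : SuperCoercive φ) (hf : Proper f) (hg : Proper g) (hlam : 0 < lam) (M : ℝ) :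
    ∃ R : ℝ, ∀ u x, x ∈ dom f → x ∈ dom φ → u ∈ dom g → objReal φ f g A lam u x ≤ M →
      ‖u‖ ≤ R ∧ ‖x‖ ≤ R := by
  have h1 := EReal.tendsto_nhds_top_iff_real.1 hcoer M
  rw [eventually_comap] at h1
  obtain ⟨R, hR⟩ := eventually_atTop.1 h1
  refine ⟨R, fun u x hxf hxφ hu hM => ?_⟩
  have h2 : ‖pair u x‖ ≤ R := by
    by_contra! hlt
    have h3 := hR _ hlt.le (pair u x) rfl
    rw [objective_eq_coe hφ hsc hf hg hlam hxf hxφ hu] at h3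
    have h3 : M < objReal φ f g A lam u x := by exact_mod_cast h3
    linarith
  exact ⟨(norm_fst_le_pair u x).trans h2, (norm_snd_le_pair u x).trans h2⟩

/-- Coercivity confines the points with nonpositive value to a ball, where every term is bounded
below; elsewhere `0` is a bound. -/
theorem Coercive.exists_objReal_lower_bound (hcoer : Coercive (objective φ f g A lam))
    (hφ : Legendre φ) (hsc : SuperCoercive φ) (hf : Proper f) (hfl : LowerSemicontinuous f)
    (hg : Proper g) (hgl : LowerSemicontinuous g) (hlam : 0 < lam) :
    ∃ c : ℝ, ∀ u x, x ∈ dom f → x ∈ dom φ → u ∈ dom g → c ≤ objReal φ f g A lam u x := by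
  obtain ⟨R, hR⟩ := hcoer.exists_radius hφ hsc hf hg hlam 0
  have hμ : 0 < 1 / lam := one_div_pos.2 hlam
  have hφp := hφ.gammaZero.proper
  have hK : IsCompact (Metric.closedBall (0 : Euc m) R) := isCompact_closedBall _ _
  have hK' : IsCompact (Metric.closedBall (0 : Euc n) R) := isCompact_closedBall _ _
  obtain ⟨cf, hcf⟩ := exists_lower_bound hf.1 hfl hK
  obtain ⟨cφ, hcφ⟩ := exists_lower_bound hφp.1 hφ.gammaZero.lsc hK
  obtain ⟨cg, hcg⟩ := exists_lower_bound hg.1 hgl hK'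
  have hA : Continuous A := A.continuous_of_finiteDimensional
  have hcont : Continuous fun p : Euc n × Euc m =>
      1 / lam * ((conj φ (A p.1)).toReal - inner ℝ (A p.1) p.2) := by
    have := (hφ.continuous_conj_toReal hsc).comp
      (hA.comp (continuous_fst : Continuous fun p : Euc n × Euc m => p.1))
    exact continuous_const.mul (this.sub ((hA.comp continuous_fst).inner continuous_snd))
  obtain ⟨cr, hcr⟩ := (hK'.prod hK).bddBelow_image hcont.continuousOn
  refine ⟨min 0 (cf + 1 / lam * cφ + cr + cg), fun u x hxf hxφ hu => ?_⟩
  rcases le_or_gt (objReal φ f g A lam u x) 0 with hle | hgt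
  · refine (min_le_right _ _).trans ?_
    obtain ⟨h1, h2⟩ := hR u x hxf hxφ hu hle
    have hx : x ∈ Metric.closedBall (0 : Euc m) R := by simpa using h2
    have hu' : u ∈ Metric.closedBall (0 : Euc n) R := by simpa using h1
    have e1 := hcf x hx
    have e2 := hcφ x hx
    have e3 := hcg u hu'
    rw [← hf.coe_toReal hxf] at e1
    rw [← hφp.coe_toReal hxφ] at e2
    rw [← hg.coe_toReal hu] at e3
    have e1 : cf ≤ (f x).toReal := by exact_mod_cast e1
    have e2 : cφ ≤ (φ x).toReal := by exact_mod_cast e2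
    have e3 : cg ≤ (g u).toReal := by exact_mod_cast e3
    have e4 := hcr ⟨(u, x), ⟨hu', hx⟩, rfl⟩
    have e5 := mul_le_mul_of_nonneg_left e2 hμ.le
    simp only at e4
    rw [objReal]
    linarith
  · exact (min_le_left _ _).trans hgt.le

theorem objective_ne_bot (hφ : Legendre φ) (hsc : SuperCoercive φ) (hf : Proper f)
    (hg : Proper g) (hlam : 0 < lam) (u : Euc n) (x : Euc m) :
    objective φ f g A lam (pair u x) ≠ ⊥ := by
  by_cases hlt : objective φ f g A lam (pair u x) < ⊤
  · obtain ⟨h1, h2, h3⟩ := objective_mem_of_lt_top hφ hsc hf hg hlam hlt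
    rw [objective_eq_coe hφ hsc hf hg hlam h1 h2 h3]
    exact EReal.coe_ne_bot _
  · rw [not_lt_top_iff.1 hlt]; exact top_ne_bot

/-- Consequences of `y` minimizing `F + D_σ(·, z)`. -/
theorem mem_argminSet_add_bregman {E : Type*} [NormedAddCommGroup E] [InnerProductSpace ℝ E]
    [CompleteSpace E] {σ F : E → EReal} (hσ : Proper σ) (hF : ∀ y, F y ≠ ⊥) {y z : E}
    (h : y ∈ argminSet fun w => F w + bregman σ w z) :
    z ∈ interior (dom σ) ∧ y ∈ dom σ ∧ F y < ⊤ ∧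
      ∀ w ∈ dom σ, F y + (bregReal σ y z : EReal) ≤ F w + (bregReal σ w z : EReal) := by
  obtain ⟨hlt, hmin⟩ := h
  have hz : z ∈ interior (dom σ) := by
    by_contra hz
    simp only [bregman_eq_top' hz, EReal.add_top_of_ne_bot (hF y)] at hlt
    exact lt_irrefl _ hlt
  have hy : y ∈ dom σ := by
    by_contra hy
    simp only [bregman_eq_top hσ hy, EReal.add_top_of_ne_bot (hF y)] at hlt
    exact lt_irrefl _ hlt
  refine ⟨hz, hy, ?_, fun w hw => ?_⟩
  · by_contra hFy
    simp only [not_lt_top_iff.1 hFy, bregman_eq_coe hσ hy hz, EReal.top_add_coe] at hlt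
    exact lt_irrefl _ hlt
  · have := hmin w
    simpa only [bregman_eq_coe hσ hy hz, bregman_eq_coe hσ hw hz] using this

variable {σ : Euc m → EReal} {ω : Euc n → EReal} {u : ℕ → Euc n} {x : ℕ → Euc m}

/-- Finiteness of the minimum, part of `argminSet`, yields all the memberships, including `u 0 ∈ dom
g`, which is not among the initial conditions. -/
theorem IsPAMRun.x_step (hrun : IsPAMRun φ σ f ω g A lam u x) (hφ : Legendre φ)
    (hsc : SuperCoercive φ) (hf : Proper f) (hg : Proper g) (hlam : 0 < lam) (hσ : Legendre σ)
    (hdom : dom φ ⊆ dom σ) (t : ℕ) :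
    x t ∈ interior (dom σ) ∧ x (t + 1) ∈ dom f ∧ x (t + 1) ∈ dom φ ∧ u t ∈ dom g ∧
      ∀ y ∈ dom f, y ∈ dom φ →
        objReal φ f g A lam (u t) (x (t + 1)) + bregReal σ (x (t + 1)) (x t) ≤
          objReal φ f g A lam (u t) y + bregReal σ y (x t) := by
  obtain ⟨h1, h2, h3, h4⟩ := mem_argminSet_add_bregman hσ.gammaZero.proper
    (fun y => objective_ne_bot hφ hsc hf hg hlam (u t) y) (hrun.x_update t)
  obtain ⟨hxf, hxφ, hu⟩ := objective_mem_of_lt_top hφ hsc hf hg hlam h3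
  refine ⟨h1, hxf, hxφ, hu, fun y hyf hyφ => ?_⟩
  have h5 := h4 y (hdom hyφ)
  rw [objective_eq_coe hφ hsc hf hg hlam hxf hxφ hu,
    objective_eq_coe hφ hsc hf hg hlam hyf hyφ hu] at h5
  exact_mod_cast h5

theorem IsPAMRun.u_step (hrun : IsPAMRun φ σ f ω g A lam u x) (hφ : Legendre φ)
    (hsc : SuperCoercive φ) (hf : Proper f) (hg : Proper g) (hlam : 0 < lam) (hω : Legendre ω)
    (hdom : dom ω = Set.univ) (t : ℕ) (w : Euc n) (hw : w ∈ dom g) :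
    objReal φ f g A lam (u (t + 1)) (x (t + 1)) + bregReal ω (u (t + 1)) (u t) ≤
      objReal φ f g A lam w (x (t + 1)) + bregReal ω w (u t) := by
  obtain ⟨-, -, h3, h4⟩ := mem_argminSet_add_bregman hω.gammaZero.proper
    (fun w => objective_ne_bot hφ hsc hf hg hlam w (x (t + 1))) (hrun.u_update t)
  obtain ⟨hxf, hxφ, hu⟩ := objective_mem_of_lt_top hφ hsc hf hg hlam h3
  have h5 := h4 w (hdom ▸ Set.mem_univ w)
  rw [objective_eq_coe hφ hsc hf hg hlam hxf hxφ hu,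
    objective_eq_coe hφ hsc hf hg hlam hxf hxφ hw] at h5
  exact_mod_cast h5

/-- At a limit point of a run, consecutive iterates have the same limit along a subsequence. -/
theorem IsPAMRun.exists_common_limit (hrun : IsPAMRun φ σ f ω g A lam u x) (hφ : Legendre φ)
    (hsc : SuperCoercive φ) (hf : Proper f) (hfl : LowerSemicontinuous f) (hg : Proper g)
    (hgl : LowerSemicontinuous g) (hlam : 0 < lam) (hσ : Legendre σ) (hdσ : dom φ ⊆ dom σ)
    (hω : Legendre ω) (hdω : dom ω = Set.univ) (hcoer : Coercive (objective φ f g A lam))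
    {us : Euc n} {xs : Euc m} (hlim : IsLimitPoint u x us xs) (hxs : xs ∈ interior (dom σ)) :
    ∃ q : ℕ → ℕ, Tendsto (fun j => u (q j)) atTop (𝓝 us) ∧
      Tendsto (fun j => x (q j)) atTop (𝓝 xs) ∧
      Tendsto (fun j => u (q j + 1)) atTop (𝓝 us) ∧
      Tendsto (fun j => x (q j + 1)) atTop (𝓝 xs) := by
  have hX := hrun.x_step hφ hsc hf hg hlam hσ hdσ
  have hU := hrun.u_step hφ hsc hf hg hlam hω hdω
  have hωi : ∀ w, w ∈ interior (dom ω) := fun w => by rw [hdω, interior_univ]; trivial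
  -- The index starts at one because `x 0` need not lie in `dom f`, where `toReal` would return a
  -- default value.
  set a : ℕ → ℝ := fun t => objReal φ f g A lam (u (t + 1)) (x (t + 1)) with ha
  set d : ℕ → ℝ := fun t => bregReal σ (x (t + 2)) (x (t + 1)) with hd
  set e : ℕ → ℝ := fun t => bregReal ω (u (t + 2)) (u (t + 1)) with he
  have hd0 : ∀ t, 0 ≤ d t := fun t =>
    hσ.bregReal_nonneg (hdσ (hX (t + 1)).2.2.1) (hX (t + 1)).1
  have he0 : ∀ t, 0 ≤ e t := fun t => hω.bregReal_nonneg (interior_subset (hωi _)) (hωi _)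
  have hstep : ∀ t, a (t + 1) + (d t + e t) ≤ a t := fun t => by
    have h1 := (hX (t + 1)).2.2.2.2 (x (t + 1)) (hX t).2.1 (hX t).2.2.1
    have h2 := hU (t + 1) (u (t + 1)) (hX (t + 1)).2.2.2.1
    rw [bregReal_self] at h1 h2
    simp only [ha, hd, he]
    linarith
  obtain ⟨c, hc⟩ := hcoer.exists_objReal_lower_bound hφ hsc hf hfl hg hgl hlam
  have hca : ∀ t, c ≤ a t := fun t => hc _ _ (hX t).2.1 (hX t).2.2.1 (hX (t + 1)).2.2.2.1
  have hdl : Tendsto d atTop (𝓝 0) :=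
    tendsto_zero_of_telescoping hd0 hca fun t => by linarith [hstep t, he0 t]
  have hel : Tendsto e atTop (𝓝 0) :=
    tendsto_zero_of_telescoping he0 hca fun t => by linarith [hstep t, hd0 t]
  have hanti : Antitone a := antitone_nat_of_succ_le fun t => by linarith [hstep t, hd0 t, he0 t]
  obtain ⟨R, hR⟩ := hcoer.exists_radius hφ hsc hf hg hlam (a 0)
  have hbd : ∀ t, ‖u (t + 1)‖ ≤ R ∧ ‖x (t + 1)‖ ≤ R := fun t =>
    hR _ _ (hX t).2.1 (hX t).2.2.1 (hX (t + 1)).2.2.2.1 (hanti (Nat.zero_le t))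
  obtain ⟨s, hs, hus, hxs'⟩ := hlim
  -- Strict monotonicity gives `s (j + 1) ≥ 1`, so the truncated subtraction is harmless and the
  -- index is a successor.
  set r : ℕ → ℕ := fun j => s (j + 1) - 1 with hr
  have hrs : ∀ j, r j + 1 = s (j + 1) := fun j => by
    have := hs.id_le (j + 1)
    simp only [id] at this
    simp only [hr]; omega
  have hrl : Tendsto r atTop atTop := by
    refine tendsto_atTop_mono (f := fun j => j) (fun j => ?_) tendsto_id
    have := hs.id_le (j + 1)
    simp only [id] at this
    simp only [hr]; omega
  obtain ⟨⟨u', x'⟩, -, θ, hθ, hθl⟩ :=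
    ((isCompact_closedBall (0 : Euc n) R).prod (isCompact_closedBall (0 : Euc m) R)).tendsto_subseq
      (x := fun j => (u (r j + 2), x (r j + 2))) (fun j => by
        have := hbd (r j + 1)
        exact ⟨by simpa using this.1, by simpa using this.2⟩)
  have hu' : Tendsto (fun j => u (r (θ j) + 2)) atTop (𝓝 u') :=
    (continuous_fst.tendsto _).comp hθl
  have hx' : Tendsto (fun j => x (r (θ j) + 2)) atTop (𝓝 x') :=
    (continuous_snd.tendsto _).comp hθl
  have hu1 : Tendsto (fun j => u (r (θ j) + 1)) atTop (𝓝 us) := by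
    simp only [hrs]
    exact hus.comp ((tendsto_add_atTop_nat 1).comp hθ.tendsto_atTop)
  have hx1 : Tendsto (fun j => x (r (θ j) + 1)) atTop (𝓝 xs) := by
    simp only [hrs]
    exact hxs'.comp ((tendsto_add_atTop_nat 1).comp hθ.tendsto_atTop)
  have hrθ : Tendsto (fun j => r (θ j)) atTop atTop := hrl.comp hθ.tendsto_atTop
  -- The next iterates, being bounded, were made convergent; vanishing Bregman distance identifies
  -- their limit.
  have hxe : x' = xs := hσ.eq_of_tendsto_bregReal_zero hxs hx1 hx'
    (fun j => hdσ (hX (r (θ j) + 1)).2.2.1) (hdl.comp hrθ)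
  have hue : u' = us := hω.eq_of_tendsto_bregReal_zero (hωi _) hu1 hu'
    (fun j => interior_subset (hωi _)) (hel.comp hrθ)
  subst hxe hue
  exact ⟨fun j => r (θ j) + 1, hu1, hx1, hu', hx'⟩

/-- Limit points of a run minimize the two proximal subproblems centred at themselves. -/
theorem IsPAMRun.limit_minimizes (hrun : IsPAMRun φ σ f ω g A lam u x) (hφ : Legendre φ)
    (hsc : SuperCoercive φ) (hf : Proper f) (hfl : LowerSemicontinuous f) (hg : Proper g)
    (hgl : LowerSemicontinuous g) (hlam : 0 < lam) (hσ : Legendre σ) (hdσ : dom φ ⊆ dom σ)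
    (hω : Legendre ω) (hdω : dom ω = Set.univ) (hcoer : Coercive (objective φ f g A lam))
    {us : Euc n} {xs : Euc m} (hlim : IsLimitPoint u x us xs) (hxs : xs ∈ interior (dom σ)) :
    (xs ∈ dom f ∧ xs ∈ dom φ ∧ us ∈ dom g) ∧
    (∀ y ∈ dom f, y ∈ dom φ → objReal φ f g A lam us xs ≤
      objReal φ f g A lam us y + bregReal σ y xs) ∧
    ∀ w ∈ dom g, objReal φ f g A lam us xs ≤ objReal φ f g A lam w xs + bregReal ω w us := by
  have hX := hrun.x_step hφ hsc hf hg hlam hσ hdσ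
  have hU := hrun.u_step hφ hsc hf hg hlam hω hdω
  have hωi : ∀ w, w ∈ interior (dom ω) := fun w => by rw [hdω, interior_univ]; trivial
  have hμ : 0 < 1 / lam := one_div_pos.2 hlam
  have hφp := hφ.gammaZero.proper
  have hA : Continuous A := A.continuous_of_finiteDimensional
  obtain ⟨q, hu0, hx0, hu1, hx1⟩ := hrun.exists_common_limit hφ hsc hf hfl hg hgl hlam hσ hdσ
    hω hdω hcoer hlim hxs
  have hAu0 : Tendsto (fun j => A (u (q j))) atTop (𝓝 (A us)) := (hA.tendsto _).comp hu0
  have hAu1 : Tendsto (fun j => A (u (q j + 1))) atTop (𝓝 (A us)) := (hA.tendsto _).comp hu1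
  -- Terms depending only on `u` cancel in the `x`-step and `D_σ` of the new iterate is dropped as
  -- nonnegative. Only semicontinuity of `f + φ/λ` is then needed in the limit.
  have hxlim : ∀ y ∈ dom f, y ∈ dom φ → f xs + ((1 / lam : ℝ) : EReal) * φ xs ≤
      (((f y).toReal + 1 / lam * (φ y).toReal + 1 / lam * (inner ℝ (A us) (xs - y)) +
        bregReal σ y xs : ℝ) : EReal) := fun y hyf hyφ => by
    refine le_of_lsc_of_tendsto (lsc_add_mul hf hφp hfl hφ.gammaZero.lsc hμ)
      (hx1.prodMk_nhds hx1)
      ((tendsto_const_nhds.add ((hAu0.inner (hx1.sub_const y)).const_mul (1 / lam))).add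
        (hσ.tendsto_bregReal_right hxs hx0 y)) (Eventually.of_forall fun j => ?_)
    simp only [add_mul_eq_coe hf hφp (hX (q j)).2.1 (hX (q j)).2.2.1]
    have h1 := (hX (q j)).2.2.2.2 y hyf hyφ
    have h2 := hσ.bregReal_nonneg (hdσ (hX (q j)).2.2.1) (hX (q j)).1
    simp only [objReal] at h1
    rw [inner_sub_right]
    exact_mod_cast (by linarith : (f (x (q j + 1))).toReal + 1 / lam * (φ (x (q j + 1))).toReal ≤
      (f y).toReal + 1 / lam * (φ y).toReal +
      1 / lam * (inner ℝ (A (u (q j))) (x (q j + 1)) - inner ℝ (A (u (q j))) y) +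
        bregReal σ y (x (q j)))
  -- Any competitor gives a finite bound; `x 1` is one at hand.
  obtain ⟨hxf, hxφ⟩ := mem_dom_of_add_mul_lt_top hf hφp hμ
    ((hxlim (x 1) (hX 0).2.1 (hX 0).2.2.1).trans_lt (EReal.coe_lt_top _))
  have hcc := hφ.continuous_conj_toReal hsc
  have hulim : ∀ w ∈ dom g, g us ≤
      (((g w).toReal + 1 / lam * ((conj φ (A w)).toReal - inner ℝ (A w) xs) -
        1 / lam * ((conj φ (A us)).toReal - inner ℝ (A us) xs) + bregReal ω w us : ℝ) : EReal) :=
    fun w hw => by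
    refine le_of_lsc_of_tendsto hgl hu1
      (((tendsto_const_nhds.add ((tendsto_const_nhds.sub
        (tendsto_const_nhds.inner hx1)).const_mul (1 / lam))).sub
        ((((hcc.tendsto _).comp hAu1).sub (hAu1.inner hx1)).const_mul (1 / lam))).add
        (hω.tendsto_bregReal_right (hωi us) hu0 w)) (Eventually.of_forall fun j => ?_)
    have hud := (hX (q j + 1)).2.2.2.1
    rw [← hg.coe_toReal hud]
    have h1 := hU (q j) w hw
    have h2 := hω.bregReal_nonneg (interior_subset (hωi (u (q j + 1)))) (hωi (u (q j)))
    simp only [objReal] at h1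
    simp only [Function.comp_apply]
    exact_mod_cast (by linarith : (g (u (q j + 1))).toReal ≤
      (g w).toReal + 1 / lam * ((conj φ (A w)).toReal - inner ℝ (A w) (x (q j + 1))) -
        1 / lam * ((conj φ (A (u (q j + 1)))).toReal -
          inner ℝ (A (u (q j + 1))) (x (q j + 1))) + bregReal ω w (u (q j)))
  have hug : us ∈ dom g := dom_of_le_coe (hulim (u 0) (hX 0).2.2.2.1)
  refine ⟨⟨hxf, hxφ, hug⟩, fun y hyf hyφ => ?_, fun w hw => ?_⟩
  · have h1 := hxlim y hyf hyφ
    rw [add_mul_eq_coe hf hφp hxf hxφ, inner_sub_right] at h1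
    have h1 : (f xs).toReal + 1 / lam * (φ xs).toReal ≤ (f y).toReal + 1 / lam * (φ y).toReal +
      1 / lam * (inner ℝ (A us) xs - inner ℝ (A us) y) + bregReal σ y xs := by exact_mod_cast h1
    simp only [objReal]
    linarith
  · have h1 := hg.toReal_le (hulim w hw)
    simp only [objReal]
    linarith

end Objective

/-! ### Linear growth of Bregman distances and global prox-regularity -/

section Growth

variable {E : Type*} [NormedAddCommGroup E] [InnerProductSpace ℝ E]

theorem regularSubdiff_subset_limitingSubdiff (f : E → EReal) (x : E) :
    regularSubdiff f x ⊆ limitingSubdiff f x := fun v hv =>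
  ⟨hv.1, hv.2.1, fun _ => x, fun _ => v, tendsto_const_nhds, tendsto_const_nhds, fun _ => hv,
    tendsto_const_nhds⟩

theorem Proper.regularSubdiff_estimate {f : E → EReal} (hf : Proper f) {x v : E}
    (hv : v ∈ regularSubdiff f x) {ε : ℝ} (hε : 0 < ε) :
    ∀ᶠ y in 𝓝 x, y ∈ dom f → (f x).toReal + inner ℝ v (y - x) - ε * ‖y - x‖ ≤ (f y).toReal := by
  filter_upwards [hv.2.2 ε hε] with y hy hyd
  rw [← hf.coe_toReal hyd, ← hf.coe_toReal (lt_top_iff_ne_top.2 hv.1)] at hy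
  norm_cast at hy
  linarith

variable [CompleteSpace E]

/-- At `y = x` the gradient is zero, so the proximal terms leave no trace in the first-order
conditions. -/
theorem Legendre.hasGradientAt_bregReal {σ : E → EReal} (h : Legendre σ) {x y : E}
    (hy : y ∈ interior (dom σ)) :
    HasGradientAt (fun z => bregReal σ z x) (grad σ y - grad σ x) y := by
  have h1 := hasGradientAt_iff_hasFDerivAt.1 (h.hasGradientAt hy)
  have h2 := (h1.sub_const ((σ x).toReal)).sub
    ((innerSL ℝ (grad σ x)).hasFDerivAt.comp y ((hasFDerivAt_id y).sub_const x))
  rw [hasGradientAt_iff_hasFDerivAt]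
  refine h2.congr_fderiv ?_
  ext w
  simp

variable [FiniteDimensional ℝ E]

/-- Bregman distances of Legendre functions grow at least linearly away from the centre. -/
theorem Legendre.exists_linear_growth {φ : E → EReal} (h : Legendre φ) {x₀ : E}
    (hx₀ : x₀ ∈ interior (dom φ)) {δ : ℝ} (hδ : 0 < δ) :
    ∃ c : ℝ, 0 < c ∧ ∀ x ∈ dom φ, δ ≤ ‖x - x₀‖ → c * ‖x - x₀‖ ≤ bregReal φ x x₀ := by
  obtain ⟨η, hη, hball⟩ := Metric.isOpen_iff.1 isOpen_interior x₀ hx₀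
  -- The sphere of radius `τ` lies in the interior of the domain, so the distance is continuous and
  -- positive on it, with a positive minimum.
  set τ := min δ (η / 2) with hτ
  have hτ0 : 0 < τ := lt_min hδ (half_pos hη)
  have hτη : τ < η := (min_le_right _ _).trans_lt (half_lt_self hη)
  have hsph : ∀ y ∈ Metric.sphere x₀ τ, y ∈ interior (dom φ) := fun y hy =>
    hball (by rw [Metric.mem_ball, Metric.mem_sphere.1 hy]; exact hτη)
  obtain ⟨m, hm, hmin⟩ : ∃ m : ℝ, 0 < m ∧ ∀ y ∈ Metric.sphere x₀ τ, m ≤ bregReal φ y x₀ := by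
    -- The sphere is empty when the space is trivial.
    rcases (Metric.sphere x₀ τ).eq_empty_or_nonempty with he | hne
    · exact ⟨1, one_pos, by simp [he]⟩
    · obtain ⟨y, hy, hymin⟩ := (isCompact_sphere x₀ τ).exists_isMinOn hne
        (f := fun y => bregReal φ y x₀) (fun y hy =>
          (h.hasGradientAt_bregReal (hsph y hy)).continuousAt.continuousWithinAt)
      refine ⟨_, h.bregReal_pos (interior_subset (hsph y hy)) hx₀ ?_, fun z hz => hymin hz⟩
      rintro rfl
      rw [Metric.mem_sphere, dist_self] at hy
      exact hτ0.ne hy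
  refine ⟨m / τ, by positivity, fun x hx hxδ => ?_⟩
  have hn : 0 < ‖x - x₀‖ := hδ.trans_le hxδ
  set t := τ / ‖x - x₀‖ with ht
  have ht0 : 0 < t := by positivity
  have ht1 : t ≤ 1 := by
    rw [ht, div_le_one hn]; exact (min_le_left _ _).trans hxδ
  have hy : t • x + (1 - t) • x₀ ∈ Metric.sphere x₀ τ := by
    rw [mem_sphere_iff_norm, show t • x + (1 - t) • x₀ - x₀ = t • (x - x₀) by module, norm_smul,
      Real.norm_eq_abs, abs_of_pos ht0, ht, div_mul_cancel₀ _ hn.ne']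
  have h1 := hmin _ hy
  have h2 := h.gammaZero.convexOn.2 hx (interior_subset hx₀) ht0.le (sub_nonneg.2 ht1) (by ring)
  simp only [smul_eq_mul] at h2
  -- Convexity along the ray from the centre, where the distance is zero.
  have h3 : m ≤ t * bregReal φ x x₀ := by
    rw [bregReal, show t • x + (1 - t) • x₀ - x₀ = t • (x - x₀) by module,
      inner_smul_right] at h1
    rw [bregReal]
    linarith
  rw [ht, div_mul_eq_mul_div, le_div_iff₀ hn] at h3
  rw [div_mul_eq_mul_div, div_le_iff₀ hτ0]
  linarith

/-- Relative prox-regularity at a point becomes global if `f` is minorized by a multiple of `φ`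
up to an affine function. -/
theorem RelProxRegular.exists_global {φ f : E → EReal} (hφ : Legendre φ) (hf : Proper f)
    {x₀ v₀ : E} (hpr : RelProxRegular φ f x₀ v₀) {μ C : ℝ} {y₀ : E}
    (hlow : ∀ x ∈ dom f, x ∈ dom φ → C ≤ (f x).toReal + μ * ((φ x).toReal - inner ℝ y₀ x)) :
    ∃ R : ℝ, 0 ≤ R ∧ ∀ x ∈ dom f, x ∈ dom φ →
      (f x₀).toReal + inner ℝ v₀ (x - x₀) - R * bregReal φ x x₀ ≤ (f x).toReal := by
  obtain ⟨hx₀, hft, hfb, -, hv₀, ε, r, hε, hr, hball, hineq⟩ := hpr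
  have hφp := hφ.gammaZero.proper
  have hx₀f : x₀ ∈ dom f := lt_top_iff_ne_top.2 hft
  obtain ⟨c, hc, hgrow⟩ := hφ.exists_linear_growth hx₀ hε
  -- Rewriting `φ x` through `D_φ(x, x₀)` in `hlow` leaves an affine remainder with slope `q` and
  -- constant of modulus `b`. At distance at least `ε` it is bounded by `K * ‖x - x₀‖`, hence by
  -- `K/c` times the Bregman distance.
  set q := μ • y₀ - μ • grad φ x₀ - v₀ with hq
  set b := |C - (f x₀).toReal - μ * (φ x₀).toReal + μ * inner ℝ y₀ x₀| with hb
  set K := b / ε + ‖q‖ with hK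
  refine ⟨max r (μ + K / c), hr.trans (le_max_left _ _), fun x hxf hxφ => ?_⟩
  have hD := hφ.bregReal_nonneg hxφ hx₀
  rcases lt_or_ge ‖x - x₀‖ ε with hlt | hge
  · have h1 := hineq x (mem_ball_iff_norm.2 hlt) x₀ (Metric.mem_ball_self hε) (by
      rw [← hf.coe_toReal hx₀f]
      exact_mod_cast lt_add_of_pos_right _ hε) v₀ hv₀ (by simpa using hε)
    rw [bregman_eq_coe hφp hxφ hx₀, ← hf.coe_toReal hx₀f, ← hf.coe_toReal hxf] at h1
    norm_cast at h1
    have h2 := mul_le_mul_of_nonneg_right (le_max_left r (μ + K / c)) hD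
    linarith
  · have h1 := hlow x hxf hxφ
    have h2 := hgrow x hxφ hge
    have h3 : b ≤ b / ε * ‖x - x₀‖ := by
      rw [div_mul_eq_mul_div, le_div_iff₀ hε]
      exact mul_le_mul_of_nonneg_left hge (abs_nonneg _)
    have h4 := (abs_le.1 (abs_real_inner_le_norm q (x - x₀))).1
    have h5 := neg_abs_le (C - (f x₀).toReal - μ * (φ x₀).toReal + μ * inner ℝ y₀ x₀)
    have hK0 : 0 ≤ K := by positivity
    have h6 : K * ‖x - x₀‖ ≤ K / c * bregReal φ x x₀ := by
      rw [div_mul_eq_mul_div, le_div_iff₀ hc]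
      nlinarith
    have h7 := mul_le_mul_of_nonneg_right (le_max_right r (μ + K / c)) hD
    have h8 : inner ℝ q (x - x₀) = μ * (inner ℝ y₀ x - inner ℝ y₀ x₀) -
        μ * inner ℝ (grad φ x₀) (x - x₀) - inner ℝ v₀ (x - x₀) := by
      rw [hq, inner_sub_left, inner_sub_left, inner_smul_left, inner_smul_left,
        inner_sub_right y₀]
      simp
    have h9 : (φ x).toReal = bregReal φ x x₀ + (φ x₀).toReal +
        inner ℝ (grad φ x₀) (x - x₀) := by
      rw [bregReal]; ring
    rw [h9] at h1
    have h10 : K * ‖x - x₀‖ = b / ε * ‖x - x₀‖ + ‖q‖ * ‖x - x₀‖ := by rw [hK]; ring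
    have h11 : (μ + K / c) * bregReal φ x x₀ =
        μ * bregReal φ x x₀ + K / c * bregReal φ x x₀ := by ring
    linarith

end Growth

/-! ### First-order conditions for the objective and the relaxation -/

section Stationarity

variable {n m : ℕ} {φ f : Euc m → EReal} {g : Euc n → EReal} {A : Euc n →ₗ[ℝ] Euc m} {lam : ℝ}

/-- A lower estimate of the objective by separate terms and a bilinear remainder. -/
theorem objReal_lower_estimate (hφ : Legendre φ) (hsc : SuperCoercive φ) (hlam : 0 < lam)
    (us u : Euc n) (xs x : Euc m) :
    objReal φ f g A lam us xs +
      ((f x).toReal - (f xs).toReal +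
        1 / lam * ((φ x).toReal - (φ xs).toReal - inner ℝ (A us) (x - xs))) +
      ((g u).toReal - (g us).toReal +
        1 / lam * inner ℝ (grad (conj φ) (A us) - xs) (A (u - us))) -
      1 / lam * inner ℝ (A (u - us)) (x - xs) ≤ objReal φ f g A lam u x := by
  -- The only inequality used is convexity of `φ*` at `A us`; the rest is bilinear algebra.
  have h1 := mul_le_mul_of_nonneg_left (hφ.conj_grad_ineq hsc (A us) (A u))
    (one_div_pos.2 hlam).le
  simp only [objReal, map_sub, inner_sub_left, inner_sub_right] at h1 ⊢
  rw [real_inner_comm (A u) xs, real_inner_comm (A us) xs]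
  linarith

theorem exists_norm_map_bound (A : Euc n →ₗ[ℝ] Euc m) : ∃ C : ℝ, 0 < C ∧ ∀ u, ‖A u‖ ≤ C * ‖u‖ :=
  (LinearMap.toContinuousLinearMap A).bound

/-- Convexity of `φ` and `φ*` linearizes both smooth parts from below, and the bilinear cross term
is a product of two increments. -/
theorem zero_mem_regularSubdiff_objective (hφ : Legendre φ) (hsc : SuperCoercive φ)
    (hf : Proper f) (hg : Proper g) (hlam : 0 < lam) {us : Euc n} {xs : Euc m}
    (hxs : xs ∈ interior (dom φ))
    (hfx : -((1 / lam) • (grad φ xs - A us)) ∈ regularSubdiff f xs)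
    (hgu : -((1 / lam) • LinearMap.adjoint A (grad (conj φ) (A us) - xs)) ∈ regularSubdiff g us) :
    0 ∈ regularSubdiff (objective φ f g A lam) (pair us xs) := by
  have hμ : 0 < 1 / lam := one_div_pos.2 hlam
  have hxf : xs ∈ dom f := lt_top_iff_ne_top.2 hfx.1
  have hug : us ∈ dom g := lt_top_iff_ne_top.2 hgu.1
  have hxφ := interior_subset hxs
  have hval := objective_eq_coe (A := A) hφ hsc hf hg hlam hxf hxφ hug
  refine ⟨by rw [hval]; exact EReal.coe_ne_top _, by rw [hval]; exact EReal.coe_ne_bot _,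
    fun ε hε => ?_⟩
  obtain ⟨C, hC, hCA⟩ := exists_norm_map_bound A
  have hε3 : 0 < ε / 3 := by positivity
  -- On this radius in `u` the cross term is at most `ε / 3 * ‖x - xs‖`.
  have hη : 0 < ε / 3 / (1 / lam * C) := by positivity
  have hfst : Tendsto (fun z : EucProd n m => z.fst) (𝓝 (pair us xs)) (𝓝 us) := by
    rw [tendsto_iff_norm_sub_tendsto_zero]
    refine squeeze_zero (fun _ => norm_nonneg _)
      (fun z => WithLp.norm_fst_le _ (z - pair us xs)) ?_
    exact tendsto_iff_norm_sub_tendsto_zero.1 tendsto_id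
  have hsnd : Tendsto (fun z : EucProd n m => z.snd) (𝓝 (pair us xs)) (𝓝 xs) := by
    rw [tendsto_iff_norm_sub_tendsto_zero]
    refine squeeze_zero (fun _ => norm_nonneg _)
      (fun z => WithLp.norm_snd_le _ (z - pair us xs)) ?_
    exact tendsto_iff_norm_sub_tendsto_zero.1 tendsto_id
  filter_upwards [hsnd.eventually (hf.regularSubdiff_estimate hfx hε3),
    hfst.eventually (hg.regularSubdiff_estimate hgu hε3),
    hfst.eventually (Metric.ball_mem_nhds us hη)] with z hz1 hz2 hz3
  set x := z.snd
  set u := z.fst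
  have hx : ‖x - xs‖ ≤ ‖z - pair us xs‖ := WithLp.norm_snd_le _ (z - pair us xs)
  have hu : ‖u - us‖ ≤ ‖z - pair us xs‖ := WithLp.norm_fst_le _ (z - pair us xs)
  rw [hval, inner_zero_left, zero_sub, ← EReal.coe_add]
  refine objective_ge (u := u) (x := x) hφ hsc hf hg hlam fun h1 h2 h3 => ?_
  refine le_trans ?_ (objReal_lower_estimate hφ hsc hlam us u xs x)
  have e1 := hz1 h1
  have e2 := hz2 h3
  have e3 := mul_le_mul_of_nonneg_left (hφ.grad_ineq hxs h2) hμ.le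
  rw [inner_neg_left, inner_smul_left, inner_sub_left] at e1
  rw [inner_neg_left, inner_smul_left, LinearMap.adjoint_inner_left] at e2
  simp only [RCLike.conj_to_real] at e1 e2
  have e4 : 1 / lam * inner ℝ (A (u - us)) (x - xs) ≤ ε / 3 * ‖x - xs‖ := by
    have k1 := real_inner_le_norm (A (u - us)) (x - xs)
    have k2 := mul_le_mul_of_nonneg_right (hCA (u - us)) (norm_nonneg (x - xs))
    have k3 : ‖u - us‖ < ε / 3 / (1 / lam * C) := mem_ball_iff_norm.1 hz3
    rw [lt_div_iff₀ (by positivity)] at k3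
    calc 1 / lam * inner ℝ (A (u - us)) (x - xs)
        ≤ 1 / lam * (C * ‖u - us‖ * ‖x - xs‖) :=
          mul_le_mul_of_nonneg_left (k1.trans k2) hμ.le
      _ = (‖u - us‖ * (1 / lam * C)) * ‖x - xs‖ := by ring
      _ ≤ ε / 3 * ‖x - xs‖ := mul_le_mul_of_nonneg_right k3.le (norm_nonneg _)
  have e5 := mul_le_mul_of_nonneg_left hx hε3.le
  have e6 := mul_le_mul_of_nonneg_left hu hε3.le
  linarith

/-- If `xs` is a strict minimizer of the inner problem with linear growth, the envelope satisfies
a first-order lower estimate at `us`. -/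
theorem leftEnv_eventually_ge (hφ : Legendre φ) (hsc : SuperCoercive φ) (hf : Proper f)
    (hlam : 0 < lam) {us : Euc n} {xs : Euc m} (hxs : xs ∈ interior (dom φ))
    (hgrow : ∀ x ∈ dom f, x ∈ dom φ → bregReal φ x xs ≤ (f x).toReal - (f xs).toReal +
      1 / lam * ((φ x).toReal - (φ xs).toReal - inner ℝ (A us) (x - xs)))
    {ε : ℝ} (hε : 0 < ε) :
    ∀ᶠ u in 𝓝 us, ((objReal φ f (fun _ => 0) A lam us xs +
      1 / lam * inner ℝ (grad (conj φ) (A us) - xs) (A (u - us)) - ε * ‖u - us‖ : ℝ) : EReal) ≤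
        leftEnv φ f lam (grad (conj φ) (A u)) := by
  have hμ : 0 < 1 / lam := one_div_pos.2 hlam
  obtain ⟨C, hC, hCA⟩ := exists_norm_map_bound A
  -- Two regimes for the cross term: within this distance of `xs` it is at most `ε * ‖u - us‖`;
  -- beyond it, linear growth of the Bregman distance absorbs it once `u` is close to `us`.
  have hδ : 0 < ε / (1 / lam * C) := by positivity
  obtain ⟨c, hc, hgr⟩ := hφ.exists_linear_growth hxs hδ
  have hη : 0 < c / (1 / lam * C) := by positivity
  have h0 : Proper (fun _ : Euc n => (0 : EReal)) :=
    ⟨fun _ => EReal.bot_lt_zero, 0, EReal.zero_lt_top⟩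
  filter_upwards [Metric.ball_mem_nhds us hη] with u hu
  refine le_iInf fun x => ?_
  -- With `g = 0`, the function minimized in the envelope is an instance of the objective.
  have hobj : f x + ((1 / lam : ℝ) : EReal) * bregman φ x (grad (conj φ) (A u)) =
      objective φ f (fun _ => 0) A lam (pair u x) := by
    exact (add_zero _).symm
  rw [hobj]
  refine objective_ge hφ hsc hf h0 hlam fun hxf hxφ _ => ?_
  refine le_trans ?_ (objReal_lower_estimate hφ hsc hlam us u xs x)
  have e1 := hgrow x hxf hxφ
  have e2 := hφ.bregReal_nonneg hxφ hxs
  have k1 := real_inner_le_norm (A (u - us)) (x - xs)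
  have k2 := mul_le_mul_of_nonneg_right (hCA (u - us)) (norm_nonneg (x - xs))
  have k3 := mul_le_mul_of_nonneg_left (k1.trans k2) hμ.le
  have k4 : ‖u - us‖ < c / (1 / lam * C) := mem_ball_iff_norm.1 hu
  rw [lt_div_iff₀ (by positivity)] at k4
  have e4 : 1 / lam * inner ℝ (A (u - us)) (x - xs) ≤ bregReal φ x xs + ε * ‖u - us‖ := by
    rcases lt_or_ge ‖x - xs‖ (ε / (1 / lam * C)) with hlt | hge
    · rw [lt_div_iff₀ (by positivity)] at hlt
      have := mul_le_mul_of_nonneg_right hlt.le (norm_nonneg (u - us))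
      linarith
    · have k5 := hgr x hxφ hge
      have k6 := mul_le_mul_of_nonneg_right k4.le (norm_nonneg (x - xs))
      have k7 : 0 ≤ ε * ‖u - us‖ := by positivity
      linarith
  linarith

/-- The growth condition makes `xs` attain the envelope at `us`, and the first-order slope of the
envelope is the negative of the given subgradient of `g`. -/
theorem zero_mem_regularSubdiff_relaxation (hφ : Legendre φ) (hsc : SuperCoercive φ)
    (hf : Proper f) (hg : Proper g) (hlam : 0 < lam) {us : Euc n} {xs : Euc m}
    (hxf : xs ∈ dom f) (hxs : xs ∈ interior (dom φ))
    (hgu : -((1 / lam) • LinearMap.adjoint A (grad (conj φ) (A us) - xs)) ∈ regularSubdiff g us)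
    (hgrow : ∀ x ∈ dom f, x ∈ dom φ → bregReal φ x xs ≤ (f x).toReal - (f xs).toReal +
      1 / lam * ((φ x).toReal - (φ xs).toReal - inner ℝ (A us) (x - xs))) :
    0 ∈ regularSubdiff (relaxation φ f g A lam) us := by
  have hug : us ∈ dom g := lt_top_iff_ne_top.2 hgu.1
  have h0 : Proper (fun _ : Euc n => (0 : EReal)) :=
    ⟨fun _ => EReal.bot_lt_zero, 0, EReal.zero_lt_top⟩
  have henv : leftEnv φ f lam (grad (conj φ) (A us)) =
      (objReal φ f (fun _ => 0) A lam us xs : EReal) := by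
    refine le_antisymm ?_ ?_
    · refine (iInf_le _ xs).trans (le_of_eq ?_)
      rw [← objective_eq_coe hφ hsc hf h0 hlam hxf (interior_subset hxs) (EReal.zero_lt_top)]
      exact (add_zero _).symm
    · have := (leftEnv_eventually_ge (A := A) hφ hsc hf hlam hxs hgrow one_pos).self_of_nhds
      simpa using this
  have hval : relaxation φ f g A lam us =
      ((objReal φ f (fun _ => 0) A lam us xs + (g us).toReal : ℝ) : EReal) := by
    rw [relaxation, henv, EReal.coe_add, hg.coe_toReal hug]
  refine ⟨by rw [hval]; exact EReal.coe_ne_top _, by rw [hval]; exact EReal.coe_ne_bot _,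
    fun ε hε => ?_⟩
  filter_upwards [leftEnv_eventually_ge (A := A) hφ hsc hf hlam hxs hgrow (half_pos hε),
    hgu.2.2 (ε / 2) (half_pos hε)] with u h1 h2
  rw [hval]
  refine le_trans ?_ (add_le_add h1 h2)
  rw [← hg.coe_toReal hug, EReal.toReal_coe, inner_neg_left, inner_smul_left,
    LinearMap.adjoint_inner_left, inner_zero_left]
  simp only [RCLike.conj_to_real]
  norm_cast
  linarith

variable {σ : Euc m → EReal} {ω : Euc n → EReal} {u : ℕ → Euc n} {x : ℕ → Euc m}

/-- First-order conditions at limit points of a run. -/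
theorem IsPAMRun.limit_stationary (hrun : IsPAMRun φ σ f ω g A lam u x) (hφ : Legendre φ)
    (hsc : SuperCoercive φ) (hf : Proper f) (hfl : LowerSemicontinuous f)
    (hCQ : Qualification φ f) (hg : Proper g)
    (hgl : LowerSemicontinuous g) (hlam : 0 < lam) (hσ : Legendre σ) (hdσ : dom φ ⊆ dom σ)
    (hω : Legendre ω) (hdω : dom ω = Set.univ) (hcoer : Coercive (objective φ f g A lam))
    {us : Euc n} {xs : Euc m} (hlim : IsLimitPoint u x us xs) (hxs : xs ∈ interior (dom σ)) :
    xs ∈ interior (dom φ) ∧ -((1 / lam) • (grad φ xs - A us)) ∈ regularSubdiff f xs ∧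
      -((1 / lam) • LinearMap.adjoint A (grad (conj φ) (A us) - xs)) ∈ regularSubdiff g us := by
  obtain ⟨⟨hxf, hxφ, hug⟩, hxmin, humin⟩ := hrun.limit_minimizes hφ hsc hf hfl hg hgl hlam hσ
    hdσ hω hdω hcoer hlim hxs
  have hμ : 0 < 1 / lam := one_div_pos.2 hlam
  have hωi : us ∈ interior (dom ω) := by rw [hdω, interior_univ]; trivial
  have hlin : ∀ y : Euc m, HasGradientAt (fun y => inner ℝ (A us) y) (A us) y := fun y => by
    rw [hasGradientAt_iff_hasFDerivAt]
    exact (innerSL ℝ (A us)).hasFDerivAt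
  have hint : xs ∈ interior (dom φ) := by
    -- The smooth perturbation contains `D_σ(·, xs)`, so the ball is chosen inside `int dom σ`,
    -- where `∇σ` is bounded.
    obtain ⟨L, hL⟩ := hσ.grad_bounded hxs
    obtain ⟨δ, hδ, hball⟩ := Metric.nhds_basis_closedBall.mem_iff.1
      (hL.and (isOpen_interior.mem_nhds hxs))
    refine mem_interior_of_qualified_min hf hφ hfl hxf hxφ (hCQ xs ⟨hxf, hxφ⟩)
      (ρ := fun y => -(1 / lam) * inner ℝ (A us) y + bregReal σ y xs)
      (gρ := fun y => -(1 / lam) • A us + (grad σ y - grad σ xs))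
      (L := ‖-(1 / lam) • A us‖ + (L + ‖grad σ xs‖)) hμ hδ
      (fun y hy => hasGradientAt_add (hasGradientAt_const_mul (hlin y) _)
        (hσ.hasGradientAt_bregReal (hball hy).2)) (fun y hy => ?_) (fun y _ hyf hyφ => ?_)
    · exact (norm_add_le _ _).trans (add_le_add le_rfl
        ((norm_sub_le _ _).trans (add_le_add (hball hy).1 le_rfl)))
    · have h1 := hxmin y hyf hyφ
      simp only [objReal, bregReal_self] at h1 ⊢
      linarith
  refine ⟨hint, ?_, ?_⟩
  · have hs := hasGradientAt_add (hasGradientAt_add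
      (hasGradientAt_const_mul (hφ.hasGradientAt hint) (1 / lam))
      (hasGradientAt_const_mul (hlin xs) (-(1 / lam)))) (hσ.hasGradientAt_bregReal (x := xs) hxs)
    have he : (1 / lam) • (grad φ xs - A us) =
        (1 / lam) • grad φ xs + -(1 / lam) • A us + (grad σ xs - grad σ xs) := by module
    rw [he]
    refine neg_gradient_mem_regularSubdiff hf hxf hs ?_
    filter_upwards [isOpen_interior.mem_nhds hint] with y hy c hc
    have h1 := hxmin y (dom_of_le_coe hc.le) (interior_subset hy)
    simp only [objReal, bregReal_self, hc, EReal.toReal_coe] at h1 ⊢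
    linarith
  · have hA : HasGradientAt (fun w => (conj φ (A w)).toReal - inner ℝ (A w) xs)
        (LinearMap.adjoint A (grad (conj φ) (A us) - xs)) us := by
      have h1 := hasGradientAt_iff_hasFDerivAt.1 (hφ.conj_spec hsc (A us)).2
      have hAd : HasFDerivAt A (LinearMap.toContinuousLinearMap A) us :=
        (LinearMap.toContinuousLinearMap A).hasFDerivAt
      have h2 := (h1.comp us hAd).sub ((innerSL ℝ xs).hasFDerivAt.comp us hAd)
      rw [hasGradientAt_iff_hasFDerivAt]
      have h3 := h2.congr_fderiv (g' := InnerProductSpace.toDual ℝ (Euc n)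
        (LinearMap.adjoint A (grad (conj φ) (A us) - xs))) (by
          ext w
          simp [LinearMap.adjoint_inner_left])
      refine h3.congr_of_eventuallyEq (Eventually.of_forall fun w => ?_)
      simp [real_inner_comm]
    have hs := hasGradientAt_add (hasGradientAt_const_mul hA (1 / lam))
      (hω.hasGradientAt_bregReal (x := us) hωi)
    rw [sub_self, add_zero] at hs
    refine neg_gradient_mem_regularSubdiff hg hug hs (Eventually.of_forall fun w c hc => ?_)
    have h1 := humin w (dom_of_le_coe hc.le)
    simp only [objReal, bregReal_self, hc, EReal.toReal_coe] at h1 ⊢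
    linarith

end Stationarity

end BregmanPAM

end

/-! ### The main theorem -/

theorem mainTheorem7 {m : ℕ} (φ f : BregmanPAM.Euc m → EReal)
    (hφ : BregmanPAM.Legendre φ) (hφsc : BregmanPAM.SuperCoercive φ)
    (hf : BregmanPAM.Proper f) (hflsc : LowerSemicontinuous f)
    (hdom : (BregmanPAM.dom f ∩ BregmanPAM.dom φ).Nonempty)
    (hCQ : BregmanPAM.Qualification φ f) :
    -- part one: limit points are stationary points of `F_λ`
    (∀ (n : ℕ) (σ : BregmanPAM.Euc m → EReal) (ω g : BregmanPAM.Euc n → EReal)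
        (A : BregmanPAM.Euc n →ₗ[ℝ] BregmanPAM.Euc m) (lam : ℝ),
      BregmanPAM.Legendre σ → BregmanPAM.dom φ ⊆ BregmanPAM.dom σ →
      BregmanPAM.Legendre ω → BregmanPAM.dom ω = Set.univ →
      BregmanPAM.Proper g → LowerSemicontinuous g → 0 < lam →
      BregmanPAM.Coercive (BregmanPAM.objective φ f g A lam) →
      ∀ (u : ℕ → BregmanPAM.Euc n) (x : ℕ → BregmanPAM.Euc m),
      BregmanPAM.IsPAMRun φ σ f ω g A lam u x →
      ∀ (us : BregmanPAM.Euc n) (xs : BregmanPAM.Euc m),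
      BregmanPAM.IsLimitPoint u x us xs → xs ∈ interior (BregmanPAM.dom σ) →
        0 ∈ BregmanPAM.limitingSubdiff (BregmanPAM.objective φ f g A lam)
          (BregmanPAM.pair us xs) ∧
        xs ∈ interior (BregmanPAM.dom φ) ∧
        (∃ v ∈ BregmanPAM.limitingSubdiff f xs,
          v + (1 / lam) • (BregmanPAM.grad φ xs - A us) = 0) ∧
        (∃ w ∈ BregmanPAM.limitingSubdiff g us,
          w + (1 / lam) •
            LinearMap.adjoint A (BregmanPAM.grad (BregmanPAM.conj φ) (A us) - xs) = 0)) ∧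
    -- part two: translation of stationarity to the relaxation, for all sufficiently small `λ`
    (∀ xs vs : BregmanPAM.Euc m, BregmanPAM.RelProxRegular φ f xs vs →
      ∃ lamBar : ℝ, 0 < lamBar ∧
      ∀ (n : ℕ) (σ : BregmanPAM.Euc m → EReal) (ω g : BregmanPAM.Euc n → EReal)
        (A : BregmanPAM.Euc n →ₗ[ℝ] BregmanPAM.Euc m) (lam : ℝ),
      BregmanPAM.Legendre σ → BregmanPAM.dom φ ⊆ BregmanPAM.dom σ →
      BregmanPAM.Legendre ω → BregmanPAM.dom ω = Set.univ →
      BregmanPAM.Proper g → LowerSemicontinuous g → 0 < lam → lam < lamBar →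
      BregmanPAM.Coercive (BregmanPAM.objective φ f g A lam) →
      ∀ (u : ℕ → BregmanPAM.Euc n) (x : ℕ → BregmanPAM.Euc m),
      BregmanPAM.IsPAMRun φ σ f ω g A lam u x →
      ∀ us : BregmanPAM.Euc n, BregmanPAM.IsLimitPoint u x us xs →
      A us = BregmanPAM.grad φ xs + lam • vs →
        0 ∈ BregmanPAM.limitingSubdiff (BregmanPAM.relaxation φ f g A lam) us) := by
  refine ⟨?_, ?_⟩
  · intro n σ ω g A lam hσ hdσ hω hdω hg hgl hlam hcoer u x hrun us xs hlim hxs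
    obtain ⟨hint, hfx, hgu⟩ := hrun.limit_stationary hφ hφsc hf hflsc hCQ hg hgl hlam hσ hdσ hω
      hdω hcoer hlim hxs
    exact ⟨BregmanPAM.regularSubdiff_subset_limitingSubdiff _ _
        (BregmanPAM.zero_mem_regularSubdiff_objective hφ hφsc hf hg hlam hint hfx hgu), hint,
      ⟨_, BregmanPAM.regularSubdiff_subset_limitingSubdiff _ _ hfx, neg_add_cancel _⟩,
      ⟨_, BregmanPAM.regularSubdiff_subset_limitingSubdiff _ _ hgu, neg_add_cancel _⟩⟩
  · intro xs vs hpr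
    -- `lamBar` must be fixed before any run is given, so the minorization needed for globalization
    -- is posed in terms of `f` and `φ` alone.
    by_cases hB : ∃ (μ C : ℝ) (y₀ : BregmanPAM.Euc m), ∀ x ∈ BregmanPAM.dom f,
        x ∈ BregmanPAM.dom φ → C ≤ (f x).toReal + μ * ((φ x).toReal - inner ℝ y₀ x)
    · obtain ⟨μ, C, y₀, hlow⟩ := hB
      obtain ⟨R, hR, hglob⟩ := hpr.exists_global hφ hf hlow
      -- Then `1/λ ≥ R + 1`: the weight `1/λ` on `D_φ(·, xs)` covers the loss `R` and leaves one
      -- full Bregman distance of growth.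
      refine ⟨1 / (R + 1), by positivity, ?_⟩
      intro n σ ω g A lam hσ hdσ hω hdω hg hgl hlam hlt hcoer u x hrun us hlim hAus
      obtain ⟨hint, hfx, hgu⟩ := hrun.limit_stationary hφ hφsc hf hflsc hCQ hg hgl hlam hσ hdσ hω
        hdω hcoer hlim (interior_mono hdσ hpr.1)
      refine BregmanPAM.regularSubdiff_subset_limitingSubdiff _ _
        (BregmanPAM.zero_mem_regularSubdiff_relaxation hφ hφsc hf hg hlam
          (lt_top_iff_ne_top.2 hfx.1) hint hgu fun y hyf hyφ => ?_)
      have h1 := hglob y hyf hyφ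
      have h2 := hφ.bregReal_nonneg hyφ hint
      have h3 : R + 1 ≤ 1 / lam := by
        rw [le_div_iff₀ hlam]
        rw [lt_div_iff₀ (by positivity)] at hlt
        linarith
      have h4 := mul_le_mul_of_nonneg_right h3 h2
      have h5 : (φ y).toReal - (φ xs).toReal - inner ℝ (A us) (y - xs) =
          BregmanPAM.bregReal φ y xs - lam * inner ℝ vs (y - xs) := by
        rw [hAus, inner_add_left, inner_smul_left, BregmanPAM.bregReal]
        simp only [RCLike.conj_to_real]
        ring
      have h6 : 1 / lam * (lam * inner ℝ vs (y - xs)) = inner ℝ vs (y - xs) := by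
        field_simp
      rw [h5, mul_sub, h6]
      linarith
    -- If the minorization fails, no run with coercive objective exists: the lower bound of the
    -- objective at fixed `u 0` would be such a minorization.
    · refine ⟨1, one_pos, ?_⟩
      intro n σ ω g A lam hσ hdσ hω hdω hg hgl hlam hlt hcoer u x hrun us hlim hAus
      exfalso
      obtain ⟨c, hc⟩ := hcoer.exists_objReal_lower_bound hφ hφsc hf hflsc hg hgl hlam
      have hu := (hrun.x_step hφ hφsc hf hg hlam hσ hdσ 0).2.2.2.1
      refine hB ⟨1 / lam, c - 1 / lam * (BregmanPAM.conj φ (A (u 0))).toReal - (g (u 0)).toReal,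
        A (u 0), fun y hyf hyφ => ?_⟩
      have h1 := hc (u 0) y hyf hyφ hu
      rw [BregmanPAM.objReal] at h1
      linarith
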